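/- **Setting.** Let $N\ge 1$ and $k\ge 0$ be integers, let $\phi(\tau,z)=\sum_{n\ge 0}\sum_{r^2\le 4nN}c(n,r)\,q^n\zeta^r$ be a Jacobi form of weight $k$ and index $N$, and let $F=\mathrm{Grit}(\phi)$ be its Gritsenko lift, a paramodular form of weight $k$ and level $N$. Thus $F$ has the Fourier expansion $\sum_T a(T;F)\,q^{Na}\zeta^b q'^{\,c}$ over the positive semidefinite integral binary quadratic forms $T=[Na,b,c]$, where $a(T;F)=\sum_{d\mid\gcd(a,b,c)}d^{k-1}c(ac/d^2,b/d)$ for $T\neq 0$ and $a(0;F)=-\frac{B_k}{2k}c(0,0)$ ($B_k$ being the Bernoulli number). For an integer $\Delta<0$ let $R_\Delta=\{\rho \bmod 2N:\rho^2\equiv\Delta \bmod 4N\}$. For $\rho\in R_\Delta$ let $\mathcal Q_{N,\Delta,\rho}$ be the set of positive definite forms $T=[Na,b,c]$ ($a,b,c\in\mathbb Z$) of discriminant $b^2-4Nac=\Delta$ with $b\equiv\rho\bmod 2N$; $\Gamma_0(N)$ acts on it by $T\mapsto T[U]$. Put $\varepsilon(T)=\#\{U\in\Gamma_0(N):T[U]=T\}$,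 $c_\rho(\Delta)=c\big(\tfrac{\rho^2-\Delta}{4N},\rho\big)$ and $c^*(\Delta)=\tfrac12\sum_{\rho\in R_\Delta}|c_\rho(\Delta)|$. For a fundamental discriminant $\ell$ ($\ell=1$ allowed) and a form $T=[Na,b,c]$, let $\chi_\ell(T)=0$ if $\gcd(a,b,c,\ell)>1$; otherwise let $g=\gcd(N,b,c,\ell)$ and $$\chi_\ell(T)=\left(\frac{\ell}{n}\right)\prod_{p\mid g}s_p,$$ where $n$ is any integer prime to $\ell$ represented by $[Na/g,\,b,\,cg]$, $s_p=\left(\frac{-\ell/p}{p}\right)$ for $p$ odd, and $s_2=\left(\frac{2}{t}\right)$ with $t$ the odd part of $\ell$. For $D<0$ define $$B_F(D,\rho)=\sum_{T\in\mathcal Q_{N,D,\rho}/\Gamma_0(N)}\frac{a(T;F)}{\varepsilon(T)},\qquad B_F(D)=\frac12\sum_{\rho\in R_D}|B_F(D,\rho)|,$$ and for $\ell D<0$ define $$B_{\ell,F}(D,\rho)=\sum_{T\in\mathcal Q_{N,\ell D,\rho}/\Gamma_0(N)}\chi_\ell(T)\frac{a(T;F)}{\varepsilon(T)},\qquad B_{\ell,F}(D)=\frac12\sum_{\rho\in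 R_{\ell D}}|B_{\ell,F}(D,\rho)|.$$ Let $h(D)$ be the number of $\mathrm{SL}_2(\mathbb Z)$-classes of primitive positive definite forms of discriminant $D<0$, and $w_D$ the number of units of the imaginary quadratic order of discriminant $D$. **Proposition.** 1. If $D<0$ is a fundamental discriminant, then $$B_F(D)=c^*(D)\,\frac{h(D)}{w_D}.$$ 2. Let $\ell\neq1$ and $D\neq1$ be fundamental discriminants with $\ell D<0$, and suppose that $p^2\nmid N$ for every prime $p$ dividing both $\ell$ and $D$ (for instance, $N$ squarefree). Then $B_{\ell,F}(D)=0$; also $\frac12\sum_{\rho\in R_{\ell D}}B_{\ell,F}(D,\rho)=0$, without the absolute values. Moreover, for every $\rho\in R_{\ell D}$, $$\sum_{T\in\mathcal Q_{N,\ell D,\rho}/\Gamma_0(N)}\chi_\ell(T)=0.$$ -/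

import Mathlib

open scoped MatrixGroups

noncomputable section

/-! ## Binary quadratic forms and their classes -/

/-- The integral binary quadratic form `[a, b, c] = a x² + b x y + c y²`. -/
@[ext]
structure BQForm where
  a : ℤ
  b : ℤ
  c : ℤ
deriving DecidableEq

namespace BQForm

/-- The value of the form at `(x, y)`. -/
def eval (T : BQForm) (x y : ℤ) : ℤ := T.a * x ^ 2 + T.b * x * y + T.c * y ^ 2

/-- The discriminant `b² - 4ac`. -/
def disc (T : BQForm) : ℤ := T.b ^ 2 - 4 * T.a * T.c

/-- The right action `T[U]` of `SL₂(ℤ)`: `T[U](v) = T(U v)`. -/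
def act (T : BQForm) (U : SL(2, ℤ)) : BQForm where
  a := T.a * U 0 0 ^ 2 + T.b * U 0 0 * U 1 0 + T.c * U 1 0 ^ 2
  b := 2 * T.a * U 0 0 * U 0 1 + T.b * (U 0 0 * U 1 1 + U 0 1 * U 1 0) + 2 * T.c * U 1 0 * U 1 1
  c := T.a * U 0 1 ^ 2 + T.b * U 0 1 * U 1 1 + T.c * U 1 1 ^ 2

theorem act_one (T : BQForm) : T.act 1 = T := by
  ext <;> simp [act]

theorem act_mul (T : BQForm) (U V : SL(2, ℤ)) : T.act (U * V) = (T.act U).act V := by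
  ext <;> simp [act, Matrix.mul_apply, Fin.sum_univ_two] <;> ring

/-- Equivalence under a subgroup `G` of `SL₂(ℤ)` on a set `S` of forms. -/
def classSetoid (G : Subgroup SL(2, ℤ)) (S : Set BQForm) : Setoid S where
  r T T' := ∃ U ∈ G, T.1.act U = T'.1
  iseqv :=
    { refl := fun T => ⟨1, G.one_mem, act_one _⟩
      symm := by
        rintro T T' ⟨U, hU, h⟩
        exact ⟨U⁻¹, G.inv_mem hU, by rw [← h, ← act_mul, mul_inv_cancel, act_one]⟩
      trans := by
        rintro T T' T'' ⟨U, hU, h⟩ ⟨V, hV, h'⟩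
        exact ⟨U * V, G.mul_mem hU hV, by rw [act_mul, h, h']⟩ }

/-- The set of classes `S / G`. -/
abbrev Classes (G : Subgroup SL(2, ℤ)) (S : Set BQForm) : Type := Quotient (classSetoid G S)

/-- A chosen representative of a class. -/
def Classes.rep {G : Subgroup SL(2, ℤ)} {S : Set BQForm} (q : Classes G S) : BQForm :=
  (Quotient.out q).1

/-- `𝒬_N`: the positive semidefinite forms `[N a, b, c]`. -/
def semidefForms (N : ℕ) : Set BQForm :=
  {T | (N : ℤ) ∣ T.a ∧ 0 ≤ T.a ∧ 0 ≤ T.c ∧ T.disc ≤ 0}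

/-- `𝒬_{N,Δ,ρ}`: the forms `[N a, b, c] ∈ 𝒬_N` of discriminant `Δ` with `b ≡ ρ mod 2N`. -/
def formsOf (N : ℕ) (Δ ρ : ℤ) : Set BQForm :=
  {T | T ∈ semidefForms N ∧ T.disc = Δ ∧ T.b ≡ ρ [ZMOD 2 * N]}

/-- `ε(T)`: the number of `U ∈ Γ₀(N)` with `T[U] = T`. -/
def stabCard (N : ℕ) (T : BQForm) : ℕ :=
  Nat.card {U : SL(2, ℤ) // U ∈ CongruenceSubgroup.Gamma0 N ∧ T.act U = T}

end BQForm

/-- `R_Δ = {ρ mod 2N : ρ² ≡ Δ mod 4N}`, each residue being represented by `0 ≤ ρ < 2N`. -/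
def rootsMod (N : ℕ) (Δ : ℤ) : Finset ℕ :=
  (Finset.range (2 * N)).filter fun ρ => (ρ : ℤ) ^ 2 ≡ Δ [ZMOD 4 * N]

/-! ## Discriminants -/

/-- Fundamental discriminants; `1` is one of them. -/
def IsFundDisc (D : ℤ) : Prop :=
  (D % 4 = 1 ∧ Squarefree D) ∨
    (D % 4 = 0 ∧ (D / 4 % 4 = 2 ∨ D / 4 % 4 = 3) ∧ Squarefree (D / 4))

/-- `h(D)` for `D < 0`: the number of `SL₂(ℤ)`-classes of primitive positive definite
forms of discriminant `D`. -/
def formClassNumber (D : ℤ) : ℕ :=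
  Nat.card (BQForm.Classes ⊤
    {T : BQForm | 0 < T.a ∧ T.disc = D ∧ Int.gcd T.a (Int.gcd T.b T.c) = 1})

/-- `w_D` for `D < 0`: the number of units of the quadratic order `ℤ[ω]` of discriminant `D`,
where `ω = (D + √D) / 2`, that is `ω² = (D - D²) / 4 + D ω`. -/
def unitCount (D : ℤ) : ℕ := Nat.card (QuadraticAlgebra ℤ ((D - D ^ 2) / 4) D)ˣ

/-! ## The genus character -/

/-- The Kronecker symbol `(m / n)` for integers `m`, `n`. -/
def kronecker (m n : ℤ) : ℤ :=
  if n = 0 then (if m.natAbs = 1 then 1 else 0)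
  else (if m < 0 ∧ n < 0 then -1 else 1) * ZMod.χ₈ (m : ZMod 8) ^ padicValNat 2 n.natAbs *
    jacobiSym m (n.natAbs / 2 ^ padicValNat 2 n.natAbs)

/-- The local sign `s_p` attached to a prime `p ∣ ℓ`: it is `((-ℓ/p) / p)` for `p` odd, and
`(2 / t)` with `t` the odd part of `ℓ` for `p = 2`. -/
def localSign (ℓ : ℤ) (p : ℕ) : ℤ :=
  if p = 2 then kronecker 2 (ℓ / 2 ^ padicValInt 2 ℓ) else kronecker (-(ℓ / p)) p

/-- For `T = [N a, b, c]`, the integer `g = gcd(N, b, c, ℓ)`. -/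
def genusGcd (N : ℕ) (ℓ : ℤ) (T : BQForm) : ℕ :=
  Nat.gcd N (Nat.gcd T.b.natAbs (Nat.gcd T.c.natAbs ℓ.natAbs))

/-- For `T = [N a, b, c]`, the form `[N a / g, b, c g]`. -/
def tildeForm (N : ℕ) (ℓ : ℤ) (T : BQForm) : BQForm :=
  ⟨T.a / genusGcd N ℓ T, T.b, T.c * genusGcd N ℓ T⟩

/-- The genus character `χ_ℓ` on forms `T = [N a, b, c]`. If `gcd(a, b, c, ℓ) = 1` it is
`(ℓ / n) ∏_{p ∣ g} s_p`, where `n` is an integer prime to `ℓ` represented by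
`[N a / g, b, c g]`; it is `0` on the other forms. -/
def genusChar (N : ℕ) (ℓ : ℤ) (T : BQForm) : ℤ :=
  if Nat.gcd (T.a / N).natAbs (Nat.gcd T.b.natAbs (Nat.gcd T.c.natAbs ℓ.natAbs)) = 1 then
    kronecker ℓ (Classical.epsilon fun n : ℤ =>
        (∃ x y : ℤ, (tildeForm N ℓ T).eval x y = n) ∧ IsCoprime n ℓ) *
      ∏ p ∈ (genusGcd N ℓ T).primeFactors, localSign ℓ p
  else 0

/-! ## Jacobi forms -/

/-- `e(x) = exp(2πix)`. -/
def cexp2pi (x : ℂ) : ℂ := Complex.exp (2 * Real.pi * Complex.I * x)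

/-- Jacobi forms of weight `k` and index `N` on the full Jacobi group `SL₂(ℤ) ⋉ ℤ²`, with their
Fourier coefficients `c(n, r)`, so that `φ(τ, z) = ∑ c(n, r) qⁿ ζʳ`, over `r² ≤ 4nN`. -/
structure JacobiForm (k N : ℕ) where
  toFun : ℂ × ℂ → ℂ
  /-- The Fourier coefficients; they are determined by `toFun` through `hasSum`. -/
  coeff : ℤ → ℤ → ℂ
  holo : DifferentiableOn ℂ toFun {p | 0 < p.1.im}
  modular : ∀ (γ : SL(2, ℤ)) (τ z : ℂ), 0 < τ.im →
    toFun (((γ 0 0 : ℂ) * τ + (γ 0 1 : ℂ)) / ((γ 1 0 : ℂ) * τ + (γ 1 1 : ℂ)),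
        z / ((γ 1 0 : ℂ) * τ + (γ 1 1 : ℂ))) =
      ((γ 1 0 : ℂ) * τ + (γ 1 1 : ℂ)) ^ k *
        cexp2pi (N * (γ 1 0 : ℂ) * z ^ 2 / ((γ 1 0 : ℂ) * τ + (γ 1 1 : ℂ))) * toFun (τ, z)
  elliptic : ∀ (l m : ℤ) (τ z : ℂ), 0 < τ.im →
    toFun (τ, z + l * τ + m) = cexp2pi (-(N * (l ^ 2 * τ + 2 * l * z))) * toFun (τ, z)
  coeff_eq_zero : ∀ n r : ℤ, 4 * n * N < r ^ 2 → coeff n r = 0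
  hasSum : ∀ τ z : ℂ, 0 < τ.im →
    HasSum (fun p : ℤ × ℤ => coeff p.1 p.2 * cexp2pi (p.1 * τ + p.2 * z)) (toFun (τ, z))

namespace JacobiForm

variable {k N : ℕ}

/-- `c_ρ(Δ) = c((ρ² - Δ)/4N, ρ)`. -/
def coeffRho (φ : JacobiForm k N) (Δ ρ : ℤ) : ℂ := φ.coeff ((ρ ^ 2 - Δ) / (4 * N)) ρ

/-- `c*(Δ) = ½ ∑_{ρ ∈ R_Δ} |c_ρ(Δ)|`. -/
def coeffStar (φ : JacobiForm k N) (Δ : ℤ) : ℝ :=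
  1 / 2 * ∑ ρ ∈ rootsMod N Δ, ‖φ.coeffRho Δ ρ‖

/-- The coefficient at `T = [N a, b, c] ∈ 𝒬_N` of the Gritsenko lift of `φ`:
`∑_{d ∣ gcd(a, b, c)} d^{k-1} c(ac/d², b/d)` if `T ≠ 0`, and `-(B_k / 2k) c(0, 0)` if `T = 0`. -/
def gritCoeff (φ : JacobiForm k N) (T : BQForm) : ℂ :=
  if T = ⟨0, 0, 0⟩ then -((bernoulli k : ℚ) : ℂ) / (2 * k) * φ.coeff 0 0
  else ∑ d ∈ (Nat.gcd (T.a / N).natAbs (Nat.gcd T.b.natAbs T.c.natAbs)).divisors,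
    (d : ℂ) ^ ((k : ℤ) - 1) * φ.coeff (T.a / N * T.c / d ^ 2) (T.b / d)

end JacobiForm

/-! ## Paramodular forms -/

/-- The Siegel upper half space of degree two; `(τ, z, ω)` stands for the symmetric matrix
with rows `(τ, z)` and `(z, ω)`. -/
def siegelSpace : Set (ℂ × ℂ × ℂ) :=
  {Z | 0 < Z.1.im ∧ Z.2.1.im ^ 2 < Z.1.im * Z.2.2.im}

/-- The symmetric matrix of `(τ, z, ω)`. -/
def siegelMatrix (Z : ℂ × ℂ × ℂ) : Matrix (Fin 2) (Fin 2) ℂ := !![Z.1, Z.2.1; Z.2.1, Z.2.2]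

/-- The entry `(i, j)` of an element of the paramodular group lies in `paramodularPattern N i j • ℤ`. -/
def paramodularPattern (N : ℕ) : Matrix (Fin 2 ⊕ Fin 2) (Fin 2 ⊕ Fin 2) ℚ :=
  Matrix.fromBlocks !![1, 1; N, 1] !![1 / N, 1; 1, 1] !![N, N; N, 1] !![1, N; 1, 1]

/-- The paramodular group `K(N) ⊆ Sp₄(ℚ)`. -/
def paramodularGroup (N : ℕ) : Set (Matrix (Fin 2 ⊕ Fin 2) (Fin 2 ⊕ Fin 2) ℚ) :=
  {γ | γ ∈ Matrix.symplecticGroup (Fin 2) ℚ ∧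
    ∀ i j, ∃ m : ℤ, γ i j = paramodularPattern N i j * m}

/-- `C Z + D`. -/
def siegelDenom (γ : Matrix (Fin 2 ⊕ Fin 2) (Fin 2 ⊕ Fin 2) ℚ) (Z : ℂ × ℂ × ℂ) :
    Matrix (Fin 2) (Fin 2) ℂ :=
  γ.toBlocks₂₁.map (fun x : ℚ => (x : ℂ)) * siegelMatrix Z + γ.toBlocks₂₂.map (fun x : ℚ => (x : ℂ))

/-- `(A Z + B) (C Z + D)⁻¹`. -/
def siegelAct (γ : Matrix (Fin 2 ⊕ Fin 2) (Fin 2 ⊕ Fin 2) ℚ) (Z : ℂ × ℂ × ℂ) : ℂ × ℂ × ℂ :=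
  let W := (γ.toBlocks₁₁.map (fun x : ℚ => (x : ℂ)) * siegelMatrix Z +
    γ.toBlocks₁₂.map (fun x : ℚ => (x : ℂ))) * (siegelDenom γ Z)⁻¹
  (W 0 0, W 0 1, W 1 1)

/-- The space `M^k(K(N))` of paramodular forms of degree two, weight `k` and level `N`. -/
structure ParamodularForm (k N : ℕ) where
  toFun : ℂ × ℂ × ℂ → ℂ
  holo : DifferentiableOn ℂ toFun siegelSpace
  modular : ∀ γ ∈ paramodularGroup N, ∀ Z ∈ siegelSpace,
    toFun (siegelAct γ Z) = (siegelDenom γ Z).det ^ k * toFun Z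

/-- For `T = [A, b, c]`, the function `q^A ζ^b q'^c` of `Z = (τ, z, ω)`. -/
def fourierMonomial (T : BQForm) (Z : ℂ × ℂ × ℂ) : ℂ :=
  cexp2pi (T.a * Z.1 + T.b * Z.2.1 + T.c * Z.2.2)

namespace ParamodularForm

variable {k N : ℕ}

/-- The Fourier coefficient `a(T; F)`, as an integral over real parts in `[0, 1]³` along the
imaginary part `Y = I₂` (the choice of `Y` does not matter). -/
def fourierCoeff (F : ParamodularForm k N) (T : BQForm) : ℂ :=
  ∫ x in (0 : ℝ)..1, ∫ y in (0 : ℝ)..1, ∫ t in (0 : ℝ)..1,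
    F.toFun ((x : ℂ) + Complex.I, (y : ℂ), (t : ℂ) + Complex.I) *
      (fourierMonomial T ((x : ℂ) + Complex.I, (y : ℂ), (t : ℂ) + Complex.I))⁻¹

/-- `F = Grit(φ)`: the Fourier expansion of `F` is the series defining the Gritsenko lift
of `φ`. -/
def IsGrit (F : ParamodularForm k N) (φ : JacobiForm k N) : Prop :=
  ∀ Z ∈ siegelSpace, HasSum
    (fun T : BQForm.semidefForms N => φ.gritCoeff T.1 * fourierMonomial T.1 Z) (F.toFun Z)

/-- `B_F(D, ρ) = ∑ a(T; F) / ε(T)` over `T ∈ 𝒬_{N,D,ρ} / Γ₀(N)`. -/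
def avgRho (F : ParamodularForm k N) (D ρ : ℤ) : ℂ :=
  ∑ᶠ q : BQForm.Classes (CongruenceSubgroup.Gamma0 N) (BQForm.formsOf N D ρ),
    F.fourierCoeff q.rep / (q.rep.stabCard N : ℂ)

/-- `B_F(D) = ½ ∑_{ρ ∈ R_D} |B_F(D, ρ)|`. -/
def avg (F : ParamodularForm k N) (D : ℤ) : ℝ :=
  1 / 2 * ∑ ρ ∈ rootsMod N D, ‖F.avgRho D ρ‖

/-- `B_{ℓ,F}(D, ρ) = ∑ χ_ℓ(T) a(T; F) / ε(T)` over `T ∈ 𝒬_{N,ℓD,ρ} / Γ₀(N)`. -/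
def twistedAvgRho (F : ParamodularForm k N) (ℓ D ρ : ℤ) : ℂ :=
  ∑ᶠ q : BQForm.Classes (CongruenceSubgroup.Gamma0 N) (BQForm.formsOf N (ℓ * D) ρ),
    (genusChar N ℓ q.rep : ℂ) * (F.fourierCoeff q.rep / (q.rep.stabCard N : ℂ))

/-- `B_{ℓ,F}(D) = ½ ∑_{ρ ∈ R_{ℓD}} |B_{ℓ,F}(D, ρ)|`. -/
def twistedAvg (F : ParamodularForm k N) (ℓ D : ℤ) : ℝ :=
  1 / 2 * ∑ ρ ∈ rootsMod N (ℓ * D), ‖F.twistedAvgRho ℓ D ρ‖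

/-- The variant `½ ∑_{ρ ∈ R_{ℓD}} B_{ℓ,F}(D, ρ)` without absolute values. -/
def signedTwistedAvg (F : ParamodularForm k N) (ℓ D : ℤ) : ℂ :=
  1 / 2 * ∑ ρ ∈ rootsMod N (ℓ * D), F.twistedAvgRho ℓ D ρ

end ParamodularForm

end

/-!
# Averages of the Fourier coefficients of Gritsenko lifts over form classes
-/

/-! ## Fourier coefficients -/

/-! Let T = [Na, b, c] have discriminant Δ and coprime a, b, c. Then a(T;F)/ε(T) depends only on Δ
and on ρ = b mod 2N. Only d = 1 survives in the divisor sum. The elliptic law of φ makes c(ac, b) a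
function of Δ and ρ (`JacobiForm.coeff_eq_coeffRho`), and the automorphs of T in Γ₀(N) are the units
of the order of discriminant Δ (`stabCard_eq_unitCount`). That a(T;F), defined as an integral, is
the coefficient of the Gritsenko series follows by integrating that series term by term.

If D is fundamental, a, b, c are always coprime. Hence B_F(D, ρ) is c_ρ(D)/w_D times the number of
Γ₀(N)-classes, and this number is h(D) by `card_classes_formsOf`.

In discriminant ℓD, a prime dividing a, b and c divides ℓ, so a, b, c are coprime wherever χ_ℓ does
not vanish. Everything reduces to the vanishing of the sum of χ_ℓ. In place of orthogonality on a
class group, one prime q with (ℓ/q) = (D/q) = -1 is used. Then ℓD is a nonzero square mod q, with a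
root r say. Every class contains forms [A, b, cq] with b ≡ r mod q, and [A, b, cq] ↦ [Aq, b, c]
permutes the classes, as multiplication by a prime ideal above q would. The permutation changes the
sign of χ_ℓ because (ℓ/q) = -1 (`genusChar_mul_prime`), so the sum equals its own negative
(`finsum_classes_eq_zero`). -/

theorem HasSum.of_forall_eq {ι : Type*} {f g : ι → ℂ} {a : ℂ} (h : ∀ i, f i = g i)
    (hf : HasSum f a) : HasSum g a :=
  (funext h : f = g) ▸ hf

theorem cexp2pi_add (x y : ℂ) : cexp2pi (x + y) = cexp2pi x * cexp2pi y := by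
  simp only [cexp2pi, ← Complex.exp_add]; ring_nf

theorem cexp2pi_zero : cexp2pi 0 = 1 := by simp [cexp2pi]

theorem cexp2pi_neg (x : ℂ) : cexp2pi (-x) = (cexp2pi x)⁻¹ := by
  simp [cexp2pi, Complex.exp_neg]

theorem norm_cexp2pi_int_mul (n : ℤ) (t : ℝ) : ‖cexp2pi (n * t)‖ = 1 := by
  have : cexp2pi (n * t) = Complex.exp ((2 * Real.pi * n * t : ℝ) * Complex.I) := by
    simp only [cexp2pi]; push_cast; ring_nf
  rw [this, Complex.norm_exp_ofReal_mul_I]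

theorem continuous_cexp2pi : Continuous cexp2pi := by
  unfold cexp2pi; fun_prop

theorem integral_cexp2pi_int_mul (n : ℤ) :
    ∫ t in (0 : ℝ)..1, cexp2pi (n * t) = if n = 0 then 1 else 0 := by
  split_ifs with h
  · simp [h, cexp2pi_zero]
  · have hc : (2 * Real.pi * Complex.I * n : ℂ) ≠ 0 := by
      simp [Real.pi_ne_zero, h]
    have := integral_exp_mul_complex (a := 0) (b := 1) hc
    have h1 : Complex.exp (2 * Real.pi * Complex.I * n) = 1 := by
      rw [mul_comm]; exact Complex.exp_int_mul_two_pi_mul_I n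
    simp only [Complex.ofReal_one, mul_one, h1, Complex.ofReal_zero, mul_zero, Complex.exp_zero,
      sub_self, zero_div] at this
    rw [← this]
    congr 1; ext t; simp only [cexp2pi]; ring_nf

/-- The characters have modulus one, so ‖u i‖ dominates and the series may be integrated term by
term; orthogonality keeps only the constant ones. -/
theorem hasSum_integral_cexp2pi {ι : Type*} [Countable ι] {u : ι → ℂ} (m : ι → ℤ)
    (hu : Summable fun i => ‖u i‖) {G : ℝ → ℂ}
    (hG : ∀ t : ℝ, HasSum (fun i => u i * cexp2pi (m i * t)) (G t)) :
    HasSum (fun i => if m i = 0 then u i else 0) (∫ t in (0 : ℝ)..1, G t) := by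
  have key := intervalIntegral.hasSum_integral_of_dominated_convergence (μ := MeasureTheory.volume)
    (a := 0) (b := 1) (F := fun i (t : ℝ) => u i * cexp2pi (m i * t)) (f := G)
    (fun i _ => ‖u i‖)
    (fun i => (continuous_const.mul (continuous_cexp2pi.comp (by fun_prop))).aestronglyMeasurable)
    (fun i => Filter.Eventually.of_forall fun t _ => by
      rw [norm_mul, norm_cexp2pi_int_mul, mul_one])
    (Filter.Eventually.of_forall fun t _ => hu) (by simp)
    (Filter.Eventually.of_forall fun t _ => hG t)
  refine HasSum.of_forall_eq (fun i => ?_) key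
  rw [intervalIntegral.integral_const_mul, integral_cexp2pi_int_mul]
  split_ifs <;> simp

theorem hasSum_integral_cexp2pi₂ {ι : Type*} [Countable ι] {u : ι → ℂ} (m₁ m₂ : ι → ℤ)
    (hu : Summable fun i => ‖u i‖) {G : ℝ → ℝ → ℂ}
    (hG : ∀ x y : ℝ, HasSum (fun i => u i * cexp2pi (m₁ i * x) * cexp2pi (m₂ i * y)) (G x y)) :
    HasSum (fun i => if m₁ i = 0 ∧ m₂ i = 0 then u i else 0)
      (∫ x in (0 : ℝ)..1, ∫ y in (0 : ℝ)..1, G x y) := by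
  have hu' : Summable fun i => ‖if m₂ i = 0 then u i else 0‖ :=
    hu.of_nonneg_of_le (fun _ => norm_nonneg _) fun i => by split_ifs <;> simp
  have := hasSum_integral_cexp2pi m₁ hu' (G := fun x => ∫ y in (0 : ℝ)..1, G x y) fun x => by
    have := hasSum_integral_cexp2pi m₂ (u := fun i => u i * cexp2pi (m₁ i * x))
      (by simpa [norm_cexp2pi_int_mul] using hu) (hG x)
    refine HasSum.of_forall_eq (fun i => ?_) this
    split_ifs <;> simp
  refine HasSum.of_forall_eq (fun i => ?_) this
  simp only [ite_and]

theorem hasSum_integral_cexp2pi₃ {ι : Type*} [Countable ι] {u : ι → ℂ} (m₁ m₂ m₃ : ι → ℤ)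
    (hu : Summable fun i => ‖u i‖) {G : ℝ → ℝ → ℝ → ℂ}
    (hG : ∀ x y t : ℝ, HasSum
      (fun i => u i * cexp2pi (m₁ i * x) * cexp2pi (m₂ i * y) * cexp2pi (m₃ i * t)) (G x y t)) :
    HasSum (fun i => if m₁ i = 0 ∧ m₂ i = 0 ∧ m₃ i = 0 then u i else 0)
      (∫ x in (0 : ℝ)..1, ∫ y in (0 : ℝ)..1, ∫ t in (0 : ℝ)..1, G x y t) := by
  have hu' : Summable fun i => ‖if m₂ i = 0 ∧ m₃ i = 0 then u i else 0‖ :=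
    hu.of_nonneg_of_le (fun _ => norm_nonneg _) fun i => by split_ifs <;> simp
  have := hasSum_integral_cexp2pi m₁ hu'
    (G := fun x => ∫ y in (0 : ℝ)..1, ∫ t in (0 : ℝ)..1, G x y t) fun x => by
    have := hasSum_integral_cexp2pi₂ m₂ m₃ (u := fun i => u i * cexp2pi (m₁ i * x))
      (by simpa [norm_cexp2pi_int_mul] using hu) (hG x)
    refine HasSum.of_forall_eq (fun i => ?_) this
    split_ifs <;> simp
  refine HasSum.of_forall_eq (fun i => ?_) this
  simp only [ite_and]

instance : Countable BQForm :=
  Function.Injective.countable (f := fun T : BQForm => (T.a, T.b, T.c)) fun S T h => by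
    simp only [Prod.mk.injEq] at h
    exact BQForm.ext h.1 h.2.1 h.2.2

/-- The Fourier coefficients of `Grit(φ)` are those of the defining series. -/
theorem ParamodularForm.IsGrit.fourierCoeff_eq {k N : ℕ} {F : ParamodularForm k N}
    {φ : JacobiForm k N} (hF : F.IsGrit φ) {T : BQForm} (hT : T ∈ BQForm.semidefForms N) :
    F.fourierCoeff T = φ.gritCoeff T := by
  let u : BQForm.semidefForms N → ℂ := fun S => φ.gritCoeff S.1 *
    cexp2pi (((S.1.a - T.a : ℤ) : ℂ) * Complex.I + ((S.1.c - T.c : ℤ) : ℂ) * Complex.I)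
  have hG : ∀ x y t : ℝ, HasSum (fun S : BQForm.semidefForms N =>
      u S * cexp2pi ((S.1.a - T.a : ℤ) * x) * cexp2pi ((S.1.b - T.b : ℤ) * y) *
        cexp2pi ((S.1.c - T.c : ℤ) * t))
      (F.toFun ((x : ℂ) + Complex.I, (y : ℂ), (t : ℂ) + Complex.I) *
        (fourierMonomial T ((x : ℂ) + Complex.I, (y : ℂ), (t : ℂ) + Complex.I))⁻¹) := by
    intro x y t
    have h := (hF ((x : ℂ) + Complex.I, (y : ℂ), (t : ℂ) + Complex.I)
      (by simp [siegelSpace])).mul_right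
      (fourierMonomial T ((x : ℂ) + Complex.I, (y : ℂ), (t : ℂ) + Complex.I))⁻¹
    refine HasSum.of_forall_eq (fun S => ?_) h
    simp only [u, fourierMonomial, ← cexp2pi_neg, mul_assoc, ← cexp2pi_add]
    congr 2
    push_cast; ring
  -- At x = y = t = 0 all characters are 1, and convergence of a sum in ℂ over an index set is
  -- absolute.
  have hu : Summable fun S => ‖u S‖ := by
    have := (hG 0 0 0).summable.norm
    simpa [cexp2pi_zero] using this
  have h := hasSum_integral_cexp2pi₃ _ _ _ hu hG
  refine h.unique ?_
  have hs := hasSum_single (f := fun S : BQForm.semidefForms N =>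
    if S.1.a - T.a = 0 ∧ S.1.b - T.b = 0 ∧ S.1.c - T.c = 0 then u S else 0) ⟨T, hT⟩
    fun S hS => by
      rw [if_neg]
      rintro ⟨h1, h2, h3⟩
      exact hS (Subtype.ext (BQForm.ext (sub_eq_zero.mp h1) (sub_eq_zero.mp h2)
        (sub_eq_zero.mp h3)))
  simpa [u, cexp2pi_zero] using hs

/-- `c(n, r)` depends only on `4nN - r²` and `r mod 2N`. -/
theorem JacobiForm.coeff_shift {k N : ℕ} (φ : JacobiForm k N) (n r l : ℤ) :
    φ.coeff n r = φ.coeff (n + l * r + N * l ^ 2) (r + 2 * N * l) := by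
  -- G is φ(τ, y + lτ) at τ = x + i, divided by one exponential. Its mean over a period is computed
  -- twice, from the expansion at the shifted point and from the elliptic law.
  let G : ℝ → ℝ → ℂ := fun x y =>
    φ.toFun ((x : ℂ) + Complex.I, (y : ℂ) + l * ((x : ℂ) + Complex.I)) *
      cexp2pi (-((n + l * r) * ((x : ℂ) + Complex.I) + r * y))
  have key : ∀ (a : ℤ × ℤ → ℤ) (b : ℤ × ℤ → ℤ) (p₀ : ℤ × ℤ),
      a p₀ = 0 → b p₀ = 0 → (∀ p, a p = 0 → b p = 0 → p = p₀) →
      (∀ x y : ℝ, HasSum (fun p : ℤ × ℤ => φ.coeff p.1 p.2 *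
        cexp2pi (a p * ((x : ℂ) + Complex.I) + b p * (y : ℂ))) (G x y)) →
      φ.coeff p₀.1 p₀.2 = ∫ x in (0 : ℝ)..1, ∫ y in (0 : ℝ)..1, G x y := by
    intro a b p₀ ha hb hab hG
    have hG' : ∀ x y : ℝ, HasSum (fun p : ℤ × ℤ => (φ.coeff p.1 p.2 *
        cexp2pi (a p * Complex.I)) * cexp2pi (a p * x) * cexp2pi (b p * y)) (G x y) := by
      intro x y
      refine HasSum.of_forall_eq (fun p => ?_) (hG x y)
      simp only [mul_assoc, ← cexp2pi_add]
      congr 2; ring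
    have hu : Summable fun p : ℤ × ℤ => ‖φ.coeff p.1 p.2 * cexp2pi (a p * Complex.I)‖ := by
      have := (hG' 0 0).summable.norm
      simpa [cexp2pi_zero] using this
    refine HasSum.unique ?_ (hasSum_integral_cexp2pi₂ a b hu hG')
    have hs := hasSum_single (f := fun p => if a p = 0 ∧ b p = 0 then
      φ.coeff p.1 p.2 * cexp2pi (a p * Complex.I) else 0) p₀ fun p hp => by
        rw [if_neg]
        rintro ⟨h1, h2⟩
        exact hp (hab p h1 h2)
    simpa [ha, hb, cexp2pi_zero] using hs
  have e1 := key (fun p => p.1 - n + l * (p.2 - r)) (fun p => p.2 - r) (n, r) (by simp) (by simp)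
    (fun p h1 h2 => by
      simp only [h2, mul_zero] at h1
      exact Prod.ext (by simp; omega) (by simp; omega)) (fun x y => by
      have h := (φ.hasSum ((x : ℂ) + Complex.I) ((y : ℂ) + l * ((x : ℂ) + Complex.I))
        (by simp)).mul_right (cexp2pi (-((n + l * r) * ((x : ℂ) + Complex.I) + r * y)))
      refine HasSum.of_forall_eq (fun p => ?_) h
      simp only [mul_assoc, ← cexp2pi_add]
      congr 2; push_cast; ring)
  have e2 := key (fun p => p.1 - (n + l * r + N * l ^ 2)) (fun p => p.2 - (r + 2 * N * l))
    (n + l * r + N * l ^ 2, r + 2 * N * l) (by simp) (by simp)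
    (fun p h1 h2 => Prod.ext (by simp at h1 ⊢; linarith) (by simp at h2 ⊢; linarith)) (fun x y => by
      have h := ((φ.hasSum ((x : ℂ) + Complex.I) (y : ℂ) (by simp)).mul_left
        (cexp2pi (-(N * (l ^ 2 * ((x : ℂ) + Complex.I) + 2 * l * y))))).mul_right
        (cexp2pi (-((n + l * r) * ((x : ℂ) + Complex.I) + r * y)))
      have el := φ.elliptic l 0 ((x : ℂ) + Complex.I) y (by simp)
      rw [Int.cast_zero, add_zero] at el
      rw [← el] at h
      refine HasSum.of_forall_eq (fun p => ?_) h
      rw [mul_left_comm, mul_assoc, mul_assoc, ← cexp2pi_add, ← cexp2pi_add]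
      congr 2; push_cast; ring)
  rw [e1, e2]

/-- `c((ac, b)) = c_ρ(Δ)` for `[N a, b, c]` of discriminant `Δ` with `b ≡ ρ mod 2N`. -/
theorem JacobiForm.coeff_eq_coeffRho {k N : ℕ} (hN : 0 < N) (φ : JacobiForm k N) {n b Δ ρ : ℤ}
    (hΔ : b ^ 2 - 4 * N * n = Δ) (hb : b ≡ ρ [ZMOD 2 * N]) : φ.coeff n b = φ.coeffRho Δ ρ := by
  obtain ⟨l, hl⟩ := hb.dvd
  have hρ : ρ = b + 2 * N * l := by linarith
  have hn : (ρ ^ 2 - Δ) / (4 * N) = n + l * b + N * l ^ 2 := by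
    apply Int.ediv_eq_of_eq_mul_right (by positivity)
    rw [hρ, ← hΔ]; ring
  rw [coeffRho, hn, hρ, ← φ.coeff_shift]

/-! ## Forms, stabilisers and classes -/

theorem IsFundDisc.not_sq_dvd {D : ℤ} (hD : IsFundDisc D) {p : ℕ} (hp : p.Prime) (h2 : p ≠ 2) :
    ¬ (p : ℤ) ^ 2 ∣ D := by
  intro h
  have hu : ¬ IsUnit (p : ℤ) := (Nat.prime_iff_prime_int.mp hp).not_isUnit
  rcases hD with ⟨_, hs⟩ | ⟨h4, _, hs⟩
  · exact hu (hs p (by rwa [← sq]))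
  · refine hu (hs p ?_)
    rw [← sq]
    have hc : IsCoprime ((p : ℤ) ^ 2) 4 := by
      have : Nat.Coprime (p ^ 2) (2 ^ 2) :=
        Nat.Coprime.pow 2 2 ((Nat.coprime_primes hp Nat.prime_two).mpr h2)
      exact_mod_cast Nat.isCoprime_iff_coprime.mpr this
    refine hc.dvd_of_dvd_mul_left ?_
    rwa [Int.mul_ediv_cancel' (Int.dvd_of_emod_eq_zero h4)]

theorem IsFundDisc.emod_four {D : ℤ} (hD : IsFundDisc D) : D % 4 = 0 ∨ D % 4 = 1 := by
  rcases hD with h | h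
  · exact .inr h.1
  · exact .inl h.1

/-- A prime dividing a form of discriminant `ℓ D` divides both `ℓ` and `D`. -/
theorem IsFundDisc.dvd_of_dvd_form {ℓ D : ℤ} (hℓ : IsFundDisc ℓ) (hD : IsFundDisc D) {a b c : ℤ}
    (h : b ^ 2 - 4 * a * c = ℓ * D) {p : ℕ} (hp : p.Prime) (ha : (p : ℤ) ∣ a) (hb : (p : ℤ) ∣ b)
    (hc : (p : ℤ) ∣ c) : (p : ℤ) ∣ ℓ := by
  obtain ⟨a, rfl⟩ := ha
  obtain ⟨b, rfl⟩ := hb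
  obtain ⟨c, rfl⟩ := hc
  have hpp : Prime (p : ℤ) := Nat.prime_iff_prime_int.mp hp
  by_contra hn
  by_cases h2 : p = 2
  · subst h2
    have hℓ4 : ℓ % 4 = 1 := by
      rcases hℓ.emod_four with h0 | h0
      · exact absurd (by omega) hn
      · exact h0
    have hD4 : D % 4 = 0 := by
      have : (ℓ * D) % 4 = 0 := by
        rw [← h]; push_cast; ring_nf; omega
      rw [Int.mul_emod, hℓ4] at this
      omega
    rcases hD with ⟨h1, _⟩ | ⟨_, hm, _⟩
    · omega
    · have e : D = 4 * (D / 4) := by omega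
      have e2 : ℓ * (D / 4) = b ^ 2 - 4 * (a * c) := by
        rw [e] at h; push_cast at h; linarith
      have e3 : (ℓ * (D / 4)) % 4 = D / 4 % 4 := by
        rw [Int.mul_emod, hℓ4]; omega
      -- Modulo 4, D/4 agrees with ℓ · D/4 = b² - 4ac, hence is 0 or 1; a fundamental D divisible by
      -- 4 requires 2 or 3.
      have e4 : b ^ 2 % 4 = 0 ∨ b ^ 2 % 4 = 1 := by
        rcases Int.even_or_odd' b with ⟨k, rfl | rfl⟩
        · left; ring_nf; omega
        · right; ring_nf; omega
      omega
  · refine hD.not_sq_dvd hp h2 ?_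
    have hc : IsCoprime ((p : ℤ) ^ 2) ℓ :=
      IsCoprime.pow_left ((Prime.coprime_iff_not_dvd hpp).mpr hn)
    exact hc.dvd_of_dvd_mul_left ⟨b ^ 2 - 4 * a * c, by linear_combination -h⟩

theorem isFundDisc_one : IsFundDisc 1 := .inl ⟨rfl, squarefree_one⟩

theorem Nat.gcd_gcd_eq_one_of_forall_prime {a b c : ℤ}
    (h : ∀ p : ℕ, p.Prime → (p : ℤ) ∣ a → (p : ℤ) ∣ b → (p : ℤ) ∣ c → False) :
    Nat.gcd a.natAbs (Nat.gcd b.natAbs c.natAbs) = 1 := by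
  by_contra hne
  obtain ⟨p, hp, hd⟩ := Nat.exists_prime_and_dvd hne
  rw [Nat.dvd_gcd_iff, Nat.dvd_gcd_iff] at hd
  exact h p hp (Int.natCast_dvd.mpr hd.1) (Int.natCast_dvd.mpr hd.2.1) (Int.natCast_dvd.mpr hd.2.2)

theorem Int.exists_bezout_of_gcd_gcd_eq_one {a b c : ℤ}
    (h : Nat.gcd a.natAbs (Nat.gcd b.natAbs c.natAbs) = 1) :
    ∃ x y z : ℤ, x * a + y * b + z * c = 1 := by
  have h1 := Int.gcd_eq_gcd_ab a (Int.gcd b c)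
  have h2 := Int.gcd_eq_gcd_ab b c
  have h3 : Int.gcd a (Int.gcd b c) = 1 := by simpa [Int.gcd] using h
  rw [h3] at h1
  exact ⟨a.gcdA (b.gcd c), b.gcdA c * a.gcdB (b.gcd c), b.gcdB c * a.gcdB (b.gcd c), by
    rw [h2] at h1 ⊢
    push_cast at h1
    linear_combination -h1⟩

theorem SL2_det (U : SL(2, ℤ)) : U 0 0 * U 1 1 - U 0 1 * U 1 0 = 1 := by
  rw [← Matrix.det_fin_two]; exact U.2

theorem mem_Gamma0_iff_dvd {N : ℕ} {U : SL(2, ℤ)} :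
    U ∈ CongruenceSubgroup.Gamma0 N ↔ (N : ℤ) ∣ U 1 0 := by
  rw [CongruenceSubgroup.Gamma0_mem, ZMod.intCast_zmod_eq_zero_iff_dvd]

namespace BQForm

theorem act_a (T : BQForm) (U : SL(2, ℤ)) : (T.act U).a = T.eval (U 0 0) (U 1 0) := by
  simp only [act, eval]

theorem act_c (T : BQForm) (U : SL(2, ℤ)) : (T.act U).c = T.eval (U 0 1) (U 1 1) := by
  simp only [act, eval]

theorem eval_act (T : BQForm) (U : SL(2, ℤ)) (x y : ℤ) :
    (T.act U).eval x y = T.eval (U 0 0 * x + U 0 1 * y) (U 1 0 * x + U 1 1 * y) := by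
  simp only [act, eval]; ring

theorem disc_act (T : BQForm) (U : SL(2, ℤ)) : (T.act U).disc = T.disc := by
  have : (T.act U).disc = T.disc * (U 0 0 * U 1 1 - U 0 1 * U 1 0) ^ 2 := by
    simp only [act, disc]; ring
  rw [this, SL2_det]; ring

theorem eval_nonneg {T : BQForm} (hT : T.disc < 0) (ha : 0 < T.a) (x y : ℤ) : 0 ≤ T.eval x y := by
  have h : 4 * T.a * T.eval x y = (2 * T.a * x + T.b * y) ^ 2 + (-T.disc) * y ^ 2 := by
    simp only [eval, disc]; ring
  have h2 : 0 ≤ (4 * T.a) * T.eval x y := by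
    rw [h]; exact add_nonneg (sq_nonneg _) (mul_nonneg (by omega) (sq_nonneg _))
  exact nonneg_of_mul_nonneg_right h2 (by omega)

theorem pos_of_disc_neg {T : BQForm} (hT : T.disc < 0) (ha : 0 ≤ T.a) (hc : 0 ≤ T.c) :
    0 < T.a ∧ 0 < T.c := by
  simp only [disc] at hT
  refine ⟨ha.lt_of_ne ?_, hc.lt_of_ne ?_⟩
  · intro h; rw [← h] at hT; nlinarith [sq_nonneg T.b]
  · intro h; rw [← h] at hT; nlinarith [sq_nonneg T.b]

theorem a_pos_of_mem {N : ℕ} {Δ ρ : ℤ} (hΔ : Δ < 0) {T : BQForm} (hT : T ∈ formsOf N Δ ρ) :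
    0 < T.a :=
  (pos_of_disc_neg (hT.2.1 ▸ hΔ) hT.1.2.1 hT.1.2.2.1).1

theorem c_pos_of_mem {N : ℕ} {Δ ρ : ℤ} (hΔ : Δ < 0) {T : BQForm} (hT : T ∈ formsOf N Δ ρ) :
    0 < T.c :=
  (pos_of_disc_neg (hT.2.1 ▸ hΔ) hT.1.2.1 hT.1.2.2.1).2

theorem act_mem_formsOf {N : ℕ} {Δ ρ : ℤ} (hΔ : Δ < 0) {T : BQForm} (hT : T ∈ formsOf N Δ ρ)
    {U : SL(2, ℤ)} (hU : U ∈ CongruenceSubgroup.Gamma0 N) : T.act U ∈ formsOf N Δ ρ := by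
  have hd : T.disc < 0 := hT.2.1 ▸ hΔ
  have ha := a_pos_of_mem hΔ hT
  obtain ⟨s, hs⟩ := mem_Gamma0_iff_dvd.mp hU
  obtain ⟨A, hA⟩ := hT.1.1
  have hdet := SL2_det U
  refine ⟨⟨?_, ?_, ?_, ?_⟩, ?_, ?_⟩
  · rw [act_a]
    exact ⟨A * U 0 0 ^ 2 + T.b * U 0 0 * s + T.c * s * U 1 0, by
      rw [eval, hA, hs]; ring⟩
  · rw [act_a]; exact eval_nonneg hd ha _ _
  · rw [act_c]; exact eval_nonneg hd ha _ _
  · rw [disc_act]; exact hd.le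
  · rw [disc_act]; exact hT.2.1
  · refine Int.ModEq.trans ?_ hT.2.2
    refine (Int.modEq_iff_dvd.mpr ⟨A * U 0 0 * U 0 1 + T.b * U 0 1 * s + T.c * s * U 1 1, ?_⟩).symm
    simp only [act]
    rw [hA]
    rw [hs] at hdet ⊢
    linear_combination T.b * hdet

/-- An automorph of `[N a, b, c]` in `Γ₀(N)` is given by a solution of `x² + b x y + N a c y² = 1`
when `a, b, c` are coprime. -/
theorem exists_of_act_eq_self {N a b c : ℤ} (hN : N ≠ 0)
    (hprim : Nat.gcd a.natAbs (Nat.gcd b.natAbs c.natAbs) = 1) {U : SL(2, ℤ)} (hU : N ∣ U 1 0)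
    (hact : (⟨N * a, b, c⟩ : BQForm).act U = ⟨N * a, b, c⟩) :
    ∃ y : ℤ, U 1 0 = N * a * y ∧ U 1 1 = U 0 0 + b * y ∧ U 0 1 = -c * y := by
  obtain ⟨s, hs⟩ := hU
  have hdet := SL2_det U
  have e1 := congrArg BQForm.a hact
  have e2 := congrArg BQForm.b hact
  have e3 := congrArg BQForm.c hact
  simp only [act] at e1 e2 e3
  obtain ⟨α, β, γ, hbez⟩ := Int.exists_bezout_of_gcd_gcd_eq_one hprim
  rw [hs] at e1 e2 hdet
  have h2N : 2 * N ≠ 0 := by omega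
  -- `r1`, `r2`, `r3` say that (s, U 1 1 - U 0 0, -U 0 1) is proportional to (a, b, c); the Bézout
  -- relation makes the factor an integer.
  have r1 : a * (U 1 1 - U 0 0) = b * s := by
    apply mul_left_cancel₀ h2N
    linear_combination (-(2 * U 1 1)) * e1 + N * s * e2 + (2 * N * a * U 0 0 + b * N * s) * hdet
  have r2 : a * U 0 1 = -c * s := by
    apply mul_left_cancel₀ h2N
    linear_combination U 1 1 * e2 - 2 * (N * s) * e3 - (2 * N * a * U 0 1 + b * U 1 1) * hdet
  have r3 : b * U 0 1 = c * (U 0 0 - U 1 1) := by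
    apply mul_left_cancel₀ (two_ne_zero (α := ℤ))
    linear_combination (-U 0 1) * e2 + 2 * U 0 0 * e3 - (b * U 0 1 + 2 * c * U 1 1) * hdet
  refine ⟨α * s + β * (U 1 1 - U 0 0) - γ * U 0 1, ?_, ?_, ?_⟩
  · rw [hs]; linear_combination N * ((-s) * hbez - β * r1 + γ * r2)
  · linear_combination (-(U 1 1 - U 0 0)) * hbez + α * r1 + γ * r3
  · linear_combination (-(U 0 1)) * hbez + α * r2 + β * r3

/-- The automorphs of a form whose coefficients `a / N, b, c` are coprime correspond to the units
of the order of its discriminant. -/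
theorem stabCard_eq_unitCount {N : ℕ} (hN : 0 < N) {T : BQForm} (hT : T.disc < 0)
    (hNa : (N : ℤ) ∣ T.a)
    (hprim : Nat.gcd (T.a / N).natAbs (Nat.gcd T.b.natAbs T.c.natAbs) = 1) :
    T.stabCard N = unitCount T.disc := by
  obtain ⟨A, b, c⟩ := T
  obtain ⟨a, rfl : A = N * a⟩ := hNa
  have hN' : (N : ℤ) ≠ 0 := by positivity
  simp only [Int.mul_ediv_cancel_left _ hN'] at hprim
  generalize hD : disc ⟨N * a, b, c⟩ = D at hT ⊢
  simp only [disc] at hD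
  -- Since ω = e + (b + √D)/2, the unit re + im·ω gives the solution (re + e·im, im) of x² + bxy +
  -- Nacy² = 1.
  obtain ⟨e, rfl⟩ : ∃ e, b = D - 2 * e := by
    have : (D - b) % 2 = 0 := by
      rw [← hD]
      rcases Int.even_or_odd' b with ⟨k, rfl | rfl⟩ <;> ring_nf <;> omega
    exact ⟨(D - b) / 2, by omega⟩
  have hm : (D - D ^ 2) / 4 = e ^ 2 - D * e - N * a * c :=
    Int.ediv_eq_of_eq_mul_right (by norm_num) (by linear_combination -hD)
  unfold stabCard unitCount
  generalize (D - D ^ 2) / 4 = m at hm ⊢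
  have hc0 : N * a ≠ 0 := by
    rintro h; rw [h] at hD; nlinarith [sq_nonneg (D - 2 * e)]
  have hnorm : ∀ u : (QuadraticAlgebra ℤ m D)ˣ,
      u.1.re * u.1.re + D * u.1.re * u.1.im - m * u.1.im * u.1.im = 1 := by
    intro u
    have h := QuadraticAlgebra.isUnit_iff_norm_isUnit.mp u.isUnit
    rw [Int.isUnit_iff, QuadraticAlgebra.norm_def] at h
    rcases h with h | h
    · exact h
    -- Norm -1 is impossible: four times the norm is a square plus -D > 0 times a square.
    · exfalso
      have : (2 * u.1.re + D * u.1.im) ^ 2 + (-D) * u.1.im ^ 2 = 4 * (-1) := by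
        linear_combination 4 * h + u.1.im ^ 2 * hD + 4 * u.1.im ^ 2 * hm
      have h3 : 0 ≤ (-D) * u.1.im ^ 2 := mul_nonneg (by omega) (sq_nonneg _)
      nlinarith [sq_nonneg (2 * u.1.re + D * u.1.im)]
  symm
  refine Nat.card_eq_of_bijective (fun u : (QuadraticAlgebra ℤ m D)ˣ =>
    (⟨⟨!![u.1.re + e * u.1.im, -c * u.1.im; N * a * u.1.im, u.1.re + (D - e) * u.1.im], by
      rw [Matrix.det_fin_two_of]
      linear_combination hnorm u + u.1.im ^ 2 * hm⟩,
      mem_Gamma0_iff_dvd.mpr ⟨a * u.1.im, by simp; ring⟩, by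
      have h := hnorm u
      rw [BQForm.ext_iff]
      simp only [act, Matrix.of_apply, Matrix.cons_val', Matrix.cons_val_zero,
        Matrix.cons_val_one, Matrix.cons_val_fin_one]
      refine ⟨?_, ?_, ?_⟩
      · linear_combination N * a * (h + u.1.im ^ 2 * hm)
      · linear_combination (D - 2 * e) * (h + u.1.im ^ 2 * hm)
      · linear_combination c * (h + u.1.im ^ 2 * hm)⟩ :
      {U : SL(2, ℤ) // U ∈ CongruenceSubgroup.Gamma0 N ∧
        (⟨N * a, D - 2 * e, c⟩ : BQForm).act U = ⟨N * a, D - 2 * e, c⟩})) ⟨?_, ?_⟩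
  · intro u v huv
    have h := congrArg (fun U : SL(2, ℤ) => (U 1 0, U 0 0)) (congrArg Subtype.val huv)
    simp only [Matrix.of_apply, Matrix.cons_val', Matrix.cons_val_zero,
      Matrix.cons_val_one, Prod.mk.injEq, Matrix.cons_val_fin_one] at h
    have him : u.1.im = v.1.im := mul_left_cancel₀ hc0 h.1
    refine Units.ext (QuadraticAlgebra.ext ?_ him)
    have := h.2
    rw [him] at this
    linarith
  · rintro ⟨U, hU, hact⟩
    have hU' := mem_Gamma0_iff_dvd.mp hU
    have hex := exists_of_act_eq_self (a := a) (b := D - 2 * e) (c := c) hN' hprim hU' hact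
    obtain ⟨y, s1, s2, s3⟩ := hex
    have hdet := SL2_det U
    rw [s1, s2, s3] at hdet
    have hu : IsUnit (⟨U 0 0 - e * y, y⟩ : QuadraticAlgebra ℤ m D) := by
      rw [QuadraticAlgebra.isUnit_iff_norm_isUnit, QuadraticAlgebra.norm_def, Int.isUnit_iff]
      left
      linear_combination hdet - y ^ 2 * hm
    refine ⟨hu.unit, Subtype.ext (Matrix.SpecialLinearGroup.ext _ _ fun i j => ?_)⟩
    fin_cases i <;> fin_cases j
    · simp
    · simp [s3]
    · simp [s1]
    · simp [s2]; ring

end BQForm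

/-! ### Comparison of Γ₀(N)-classes with SL₂(ℤ)-classes. -/

namespace BQForm

theorem _root_.exists_prime_dvd_iff {m : ℤ} (hm : m ≠ 0) (P : ℕ → Prop) :
    ∃ X : ℕ, ∀ p : ℕ, p.Prime → (p ∣ X ↔ (p : ℤ) ∣ m ∧ P p) := by
  classical
  refine ⟨∏ p ∈ m.natAbs.primeFactors.filter P, p, fun p hp => ?_⟩
  rw [hp.prime.dvd_finsetProd_iff]
  constructor
  · rintro ⟨q, hq, hpq⟩
    rw [Finset.mem_filter, Nat.mem_primeFactors] at hq
    rw [(Nat.prime_dvd_prime_iff_eq hp hq.1.1).mp hpq]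
    exact ⟨Int.natCast_dvd.mpr hq.1.2.1, hq.2⟩
  · rintro ⟨h1, h2⟩
    exact ⟨p, Finset.mem_filter.mpr ⟨Nat.mem_primeFactors.mpr
      ⟨hp, Int.natCast_dvd.mp h1, by simpa using hm⟩, h2⟩, dvd_rfl⟩

/-- A form whose content is prime to `m` represents primitively an integer prime to `m`. -/
theorem exists_eval_isCoprime (T : BQForm) {m : ℤ} (hm : m ≠ 0)
    (h : ∀ p : ℕ, p.Prime → (p : ℤ) ∣ m → (p : ℤ) ∣ T.a → (p : ℤ) ∣ T.b → (p : ℤ) ∣ T.c → False) :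
    ∃ x y : ℤ, IsCoprime x y ∧ IsCoprime (T.eval x y) m := by
  -- For each prime p ∣ m exactly one term of aX² + bXY + cY² survives mod p: the first if p ∤ a,
  -- the last if p ∣ a and p ∤ c, the middle one if p divides both.
  obtain ⟨X, hX⟩ := exists_prime_dvd_iff hm fun p => (p : ℤ) ∣ T.a ∧ ¬ (p : ℤ) ∣ T.c
  obtain ⟨Y, hY⟩ := exists_prime_dvd_iff hm fun p => ¬ (p : ℤ) ∣ T.a
  refine ⟨X, Y, ?_, ?_⟩
  · rw [Nat.isCoprime_iff_coprime]
    exact Nat.coprime_of_dvd fun p hp h1 h2 => ((hY p hp).mp h2).2 ((hX p hp).mp h1).2.1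
  · rw [Int.isCoprime_iff_gcd_eq_one]
    refine Nat.coprime_of_dvd fun p hp h1 h2 => ?_
    have hpp : Prime (p : ℤ) := Nat.prime_iff_prime_int.mp hp
    replace h1 : (p : ℤ) ∣ T.a * X ^ 2 + T.b * X * Y + T.c * Y ^ 2 := Int.natCast_dvd.mpr h1
    replace h2 := Int.natCast_dvd.mpr h2
    replace hX := hX p hp
    replace hY := hY p hp
    rw [← Int.natCast_dvd_natCast] at hX hY
    generalize (X : ℤ) = X at *
    generalize (Y : ℤ) = Y at *
    by_cases ha : (p : ℤ) ∣ T.a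
    · have hY' : ¬ (p : ℤ) ∣ Y := fun hd => (hY.mp hd).2 ha
      by_cases hc : (p : ℤ) ∣ T.c
      · have hX' : ¬ (p : ℤ) ∣ X := fun hd => (hX.mp hd).2.2 hc
        have h3 : (p : ℤ) ∣ T.b * X * Y := by
          have := dvd_sub (dvd_sub h1 (ha.mul_right (X ^ 2))) (hc.mul_right (Y ^ 2))
          ring_nf at this ⊢
          exact this
        rcases hpp.dvd_or_dvd h3 with h3 | h3
        · rcases hpp.dvd_or_dvd h3 with h3 | h3
          · exact h p hp h2 ha h3 hc
          · exact hX' h3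
        · exact hY' h3
      · have hX' : (p : ℤ) ∣ X := hX.mpr ⟨h2, ha, hc⟩
        have h3 : (p : ℤ) ∣ T.c * Y ^ 2 := by
          have := dvd_sub h1 (hX'.mul_right (T.a * X + T.b * Y))
          ring_nf at this ⊢
          exact this
        rcases hpp.dvd_or_dvd h3 with h3 | h3
        · exact hc h3
        · exact hY' (hpp.dvd_of_dvd_pow h3)
    · have hX' : ¬ (p : ℤ) ∣ X := fun hd => ha (hX.mp hd).2.1
      have hY' : (p : ℤ) ∣ Y := hY.mpr ⟨h2, ha⟩
      have h3 : (p : ℤ) ∣ T.a * X ^ 2 := by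
        have := dvd_sub h1 (hY'.mul_right (T.b * X + T.c * Y))
        ring_nf at this ⊢
        exact this
      rcases hpp.dvd_or_dvd h3 with h3 | h3
      · exact ha h3
      · exact hX' (hpp.dvd_of_dvd_pow h3)

/-- The unipotent matrix `(1, 0; s, 1)`. -/
def lowerUnipotent (s : ℤ) : SL(2, ℤ) := ⟨!![1, 0; s, 1], by simp⟩

/-- The unipotent matrix `(1, t; 0, 1)`. -/
def upperUnipotent (t : ℤ) : SL(2, ℤ) := ⟨!![1, t; 0, 1], by simp⟩

theorem act_lowerUnipotent (T : BQForm) (s : ℤ) :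
    T.act (lowerUnipotent s) = ⟨T.a + T.b * s + T.c * s ^ 2, T.b + 2 * T.c * s, T.c⟩ := by
  rw [BQForm.ext_iff]
  simp [act, lowerUnipotent]

theorem act_upperUnipotent (T : BQForm) (t : ℤ) :
    T.act (upperUnipotent t) = ⟨T.a, T.b + 2 * T.a * t, T.a * t ^ 2 + T.b * t + T.c⟩ := by
  rw [BQForm.ext_iff]
  simp [act, upperUnipotent, add_comm]

theorem lowerUnipotent_mem {N : ℕ} {s : ℤ} (h : (N : ℤ) ∣ s) :
    lowerUnipotent s ∈ CongruenceSubgroup.Gamma0 N := by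
  rw [mem_Gamma0_iff_dvd]; simpa [lowerUnipotent] using h

theorem upperUnipotent_mem {N : ℕ} (t : ℤ) :
    upperUnipotent t ∈ CongruenceSubgroup.Gamma0 N := by
  rw [mem_Gamma0_iff_dvd]; simp [upperUnipotent]

/-- The leading coefficients and the congruence of the middle ones mod 2N show that N divides z(bx +
cz) and z(by + cw), where U = (x, y; z, w). Inverting U gives N ∣ bz and N ∣ cz, and gcd(N, b, c) =
1 leaves N ∣ z. -/
theorem mem_Gamma0_of_act_mem {N : ℕ} {Δ ρ : ℤ} {T T' : BQForm}
    (hT : T ∈ formsOf N Δ ρ) (hT' : T' ∈ formsOf N Δ ρ) {U : SL(2, ℤ)} (hU : T.act U = T')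
    (hgcd : ∀ p : ℕ, p.Prime → (p : ℤ) ∣ N → (p : ℤ) ∣ T.b → (p : ℤ) ∣ T.c → False) :
    U ∈ CongruenceSubgroup.Gamma0 N := by
  rw [mem_Gamma0_iff_dvd]
  have hdet := SL2_det U
  obtain ⟨A, hA⟩ := hT.1.1
  obtain ⟨A', hA'⟩ := hT'.1.1
  obtain ⟨B, hB⟩ := (hT.2.2.trans hT'.2.2.symm).dvd
  rw [← hU] at hA' hB
  simp only [act] at hA' hB
  rw [hA] at hA' hB
  have h1 : (N : ℤ) ∣ U 1 0 * (T.b * U 0 0 + T.c * U 1 0) :=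
    ⟨A' - A * U 0 0 ^ 2, by linear_combination hA'⟩
  have h2 : (N : ℤ) ∣ U 1 0 * (T.b * U 0 1 + T.c * U 1 1) :=
    ⟨B - A * U 0 0 * U 0 1, by
      apply mul_left_cancel₀ (two_ne_zero (α := ℤ))
      linear_combination hB - T.b * hdet⟩
  have hb : (N : ℤ) ∣ T.b * U 1 0 := by
    have e : T.b * U 1 0 = U 1 0 * (T.b * U 0 0 + T.c * U 1 0) * U 1 1 -
        U 1 0 * (T.b * U 0 1 + T.c * U 1 1) * U 1 0 := by
      linear_combination (-(T.b * U 1 0)) * hdet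
    rw [e]
    exact dvd_sub (h1.mul_right _) (h2.mul_right _)
  have hc : (N : ℤ) ∣ T.c * U 1 0 := by
    have e : T.c * U 1 0 = U 1 0 * (T.b * U 0 1 + T.c * U 1 1) * U 0 0 -
        U 1 0 * (T.b * U 0 0 + T.c * U 1 0) * U 0 1 := by
      linear_combination (-(T.c * U 1 0)) * hdet
    rw [e]
    exact dvd_sub (h2.mul_right _) (h1.mul_right _)
  have hg := Nat.gcd_gcd_eq_one_of_forall_prime hgcd
  obtain ⟨x, y, z, h⟩ := Int.exists_bezout_of_gcd_gcd_eq_one hg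
  have : U 1 0 = x * U 1 0 * N + y * (T.b * U 1 0) + z * (T.c * U 1 0) := by
    linear_combination (-(U 1 0)) * h
  rw [this]
  exact dvd_add (dvd_add (dvd_mul_left _ _) (hb.mul_left _)) (hc.mul_left _)

/-- A primitive form properly represents an integer prime to N, which can be made the last
coefficient c. As c is invertible mod N, a lower unipotent matrix brings b to ρ mod 2N, and 4ac = b²
- D ≡ 0 mod 4N then forces N ∣ a. -/
theorem exists_act_mem_formsOf {N : ℕ} (hN : 0 < N) {D ρ : ℤ} (hD : D < 0)
    (hρ : ρ ^ 2 ≡ D [ZMOD 4 * N]) {T : BQForm} (ha : 0 < T.a) (hT : T.disc = D)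
    (hgcd : Int.gcd T.a (Int.gcd T.b T.c) = 1) : ∃ U : SL(2, ℤ), T.act U ∈ formsOf N D ρ := by
  obtain ⟨x, y, hxy, hco⟩ := T.exists_eval_isCoprime (m := N) (by positivity)
    fun p hp _ h1 h2 h3 => by
      have : (p : ℤ) ∣ (Int.gcd T.a (Int.gcd T.b T.c) : ℤ) :=
        Int.dvd_coe_gcd h1 (Int.dvd_coe_gcd h2 h3)
      rw [hgcd] at this
      exact (Nat.prime_iff_prime_int.mp hp).not_isUnit (isUnit_of_dvd_one (by simpa using this))
  obtain ⟨t, s, hts⟩ := hxy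
  let V : SL(2, ℤ) := ⟨!![s, x; -t, y], by rw [Matrix.det_fin_two_of]; linarith⟩
  have hVc : (T.act V).c = T.eval x y := by rw [act_c]; simp [V]
  have hVd : (T.act V).disc = D := by rw [disc_act, hT]
  generalize hS : T.act V = S at hVc hVd
  obtain ⟨u, v, huv⟩ := hco
  rw [← hVc] at huv
  obtain ⟨m, hm⟩ := hρ.dvd
  obtain ⟨e, he⟩ : ∃ e, ρ - S.b = 2 * e := by
    have h1 : (S.b ^ 2 - ρ ^ 2) % 2 = 0 := by
      have e : S.b ^ 2 - ρ ^ 2 = 2 * (2 * S.a * S.c + 2 * (N * m)) := by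
        simp only [disc] at hVd; linear_combination hVd + hm
      rw [e]; omega
    have h2 : (ρ - S.b) % 2 = 0 := by
      rcases Int.even_or_odd' ρ with ⟨k, rfl | rfl⟩ <;>
        rcases Int.even_or_odd' S.b with ⟨l, hl | hl⟩ <;> rw [hl] at h1 ⊢ <;>
        ring_nf at h1 ⊢ <;> omega
    exact ⟨(ρ - S.b) / 2, by omega⟩
  -- Here u inverts the last coefficient mod N and ρ - b = 2e, so b + 2c·ue ≡ b + 2e mod 2N.
  refine ⟨V * lowerUnipotent (u * e), ?_⟩
  have hd' := disc_act T (V * lowerUnipotent (u * e))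
  have hpos := eval_nonneg (hT ▸ hD) ha
  have ha' := act_a T (V * lowerUnipotent (u * e))
  have hc' := act_c T (V * lowerUnipotent (u * e))
  rw [hT] at hd'
  have hb : (T.act (V * lowerUnipotent (u * e))).b ≡ ρ [ZMOD 2 * N] := by
    refine Int.modEq_iff_dvd.mpr ⟨v * e, ?_⟩
    rw [act_mul, hS, act_lowerUnipotent]
    linear_combination he - 2 * e * huv
  have hc : (T.act (V * lowerUnipotent (u * e))).c = S.c := by
    rw [act_mul, hS, act_lowerUnipotent]
  refine ⟨⟨?_, ha' ▸ hpos _ _, hc' ▸ hpos _ _, hd'.le.trans hD.le⟩, hd', hb⟩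
  generalize T.act (V * lowerUnipotent (u * e)) = R at hb hc hd'
  obtain ⟨f, hf⟩ := hb.dvd
  have h4 : (N : ℤ) ∣ R.a * S.c := by
    refine ⟨-m - f * ρ + N * f ^ 2, ?_⟩
    apply mul_left_cancel₀ (four_ne_zero (α := ℤ))
    simp only [disc] at hd'
    rw [← hc]
    have hρ : R.b = ρ - 2 * N * f := by linarith
    rw [hρ] at hd'
    linear_combination -hd' - hm
  have : R.a = u * (R.a * S.c) + R.a * v * N := by linear_combination (-R.a) * huv
  rw [this]
  exact dvd_add (h4.mul_left _) (dvd_mul_left _ _)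

/-- This is `IsFundDisc.dvd_of_dvd_form` with ℓ = 1: the prime would divide 1. -/
theorem prime_not_dvd_of_mem {N : ℕ} {D ρ : ℤ} (hD : IsFundDisc D) {T : BQForm}
    (hT : T ∈ formsOf N D ρ) {p : ℕ} (hp : p.Prime) (ha : (p : ℤ) ∣ T.a) (hb : (p : ℤ) ∣ T.b)
    (hc : (p : ℤ) ∣ T.c) : False := by
  have h := hT.2.1
  rw [disc, ← one_mul D] at h
  exact (Nat.prime_iff_prime_int.mp hp).not_isUnit
    (isUnit_of_dvd_one (isFundDisc_one.dvd_of_dvd_form hD h hp ha hb hc))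

/-- The classes of `𝒬_{N,D,ρ}` under `Γ₀(N)` correspond to the form classes of discriminant `D`. -/
theorem card_classes_formsOf {N : ℕ} (hN : 0 < N) {D ρ : ℤ} (hD : IsFundDisc D) (hD0 : D < 0)
    (hρ : ρ ^ 2 ≡ D [ZMOD 4 * N]) :
    Nat.card (Classes (CongruenceSubgroup.Gamma0 N) (formsOf N D ρ)) = formClassNumber D := by
  unfold formClassNumber
  let ι : formsOf N D ρ → {T : BQForm | 0 < T.a ∧ T.disc = D ∧ Int.gcd T.a (Int.gcd T.b T.c) = 1} :=
    fun T => ⟨T.1, a_pos_of_mem hD0 T.2, T.2.2.1,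
      Nat.gcd_gcd_eq_one_of_forall_prime fun p hp => prime_not_dvd_of_mem hD T.2 hp⟩
  refine Nat.card_eq_of_bijective (Quotient.map (sa := classSetoid _ _) (sb := classSetoid _ _) ι
    fun T T' ⟨U, _, h⟩ => ⟨U, trivial, h⟩) ⟨?_, ?_⟩
  · rintro ⟨T⟩ ⟨T'⟩ h
    obtain ⟨U, -, hU⟩ := Quotient.exact h
    refine Quotient.sound ⟨U, mem_Gamma0_of_act_mem T.2 T'.2 hU fun p hp h1 => ?_, hU⟩
    exact prime_not_dvd_of_mem hD T.2 hp (h1.trans T.2.1.1)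
  · rintro ⟨T, ha, hd, hg⟩
    obtain ⟨U, hU⟩ := exists_act_mem_formsOf hN hD0 hρ ha hd hg
    exact ⟨Quotient.mk _ ⟨_, hU⟩, Quotient.sound ⟨U⁻¹, trivial, by
      change (T.act U).act U⁻¹ = T
      rw [← act_mul, mul_inv_cancel, act_one]⟩⟩

end BQForm

/-! ## The Kronecker symbol -/

theorem kronecker_two_pow_mul (m : ℤ) (e : ℕ) {t : ℕ} (ht : Odd t) :
    kronecker m ((2 ^ e * t : ℕ) : ℤ) = ZMod.χ₈ (m : ZMod 8) ^ e * jacobiSym m t := by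
  have ht0 : t ≠ 0 := by rintro rfl; simp at ht
  have hv : padicValNat 2 (2 ^ e * t) = e := by
    rw [padicValNat.mul (by positivity) ht0, padicValNat.prime_pow,
      padicValNat.eq_zero_of_not_dvd ht.not_two_dvd_nat, add_zero]
  have h0 : ((2 ^ e * t : ℕ) : ℤ) ≠ 0 := by exact_mod_cast mul_ne_zero (by positivity) ht0
  rw [kronecker, if_neg h0, if_neg (by rintro ⟨-, h⟩; omega), one_mul, Int.natAbs_natCast, hv,
    Nat.mul_div_cancel_left _ (by positivity)]

theorem kronecker_odd (m : ℤ) {t : ℕ} (ht : Odd t) : kronecker m t = jacobiSym m t := by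
  simpa using kronecker_two_pow_mul m 0 ht

theorem kronecker_mul_right (m : ℤ) {a b : ℕ} (ha : a ≠ 0) (hb : b ≠ 0) :
    kronecker m ((a * b : ℕ) : ℤ) = kronecker m a * kronecker m b := by
  obtain ⟨e, s, hs, rfl⟩ := Nat.exists_eq_two_pow_mul_odd ha
  obtain ⟨f, t, ht, rfl⟩ := Nat.exists_eq_two_pow_mul_odd hb
  rw [show 2 ^ e * s * (2 ^ f * t) = 2 ^ (e + f) * (s * t) by ring,
    kronecker_two_pow_mul _ _ hs, kronecker_two_pow_mul _ _ ht,
    kronecker_two_pow_mul _ _ (hs.mul ht),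
    jacobiSym.mul_right' _ (by rintro rfl; simp at hs) (by rintro rfl; simp at ht), pow_add]
  ring

/-- For m < 0 one has |m| ≡ 3 mod 4, and the factor (-1/b) cancels the sign of quadratic
reciprocity. -/
theorem jacobiSym_of_emod_four_eq_one {m : ℤ} (hm : m % 4 = 1) {b : ℕ} (hb : Odd b) :
    jacobiSym m b = jacobiSym b m.natAbs := by
  rcases Int.natAbs_eq m with h | h
  · have h4 : m.natAbs % 4 = 1 := by omega
    conv_lhs => rw [h]
    exact jacobiSym.quadratic_reciprocity_one_mod_four h4 hb
  · have h4 : m.natAbs % 4 = 3 := by omega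
    conv_lhs => rw [h]
    rw [jacobiSym.neg _ hb]
    rcases Nat.odd_mod_four_iff.mp (Nat.odd_iff.mp hb) with h1 | h3
    · rw [ZMod.χ₄_nat_one_mod_four h1, one_mul,
        jacobiSym.quadratic_reciprocity_one_mod_four' (Nat.odd_iff.mpr (by omega)) h1]
    · rw [ZMod.χ₄_nat_three_mod_four h3,
        jacobiSym.quadratic_reciprocity_three_mod_four h4 h3]
      ring

theorem jacobiSym_of_emod_four_eq_three {m : ℤ} (hm : m % 4 = 3) {b : ℕ} (hb : Odd b) :
    jacobiSym m b = ZMod.χ₄ b * jacobiSym b m.natAbs := by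
  have h := jacobiSym.neg (-m) hb
  rwa [neg_neg, jacobiSym_of_emod_four_eq_one (m := -m) (by omega) hb, Int.natAbs_neg] at h

/-- The odd part of n is handled by reciprocity; the powers of 2 agree because χ₈ is even, so that
χ₈(m) = χ₈(|m|) = (2/|m|). -/
theorem kronecker_of_emod_four_eq_one {m : ℤ} (hm : m % 4 = 1) {n : ℕ} (hn : n ≠ 0) :
    kronecker m n = jacobiSym n m.natAbs := by
  obtain ⟨e, s, hs, rfl⟩ := Nat.exists_eq_two_pow_mul_odd hn
  have ho : Odd m.natAbs := Nat.odd_iff.mpr (by omega)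
  rw [kronecker_two_pow_mul _ _ hs, jacobiSym_of_emod_four_eq_one hm hs]
  push_cast
  rw [jacobiSym.mul_left, jacobiSym.pow_left, jacobiSym.at_two ho]
  congr 2
  rw [ZMod.χ₈_int_eq_if_mod_eight, ZMod.χ₈_nat_eq_if_mod_eight]
  rcases Int.natAbs_eq m with h | h <;> split_ifs <;> omega

theorem jacobiSym_sq_add_mul {y m z : ℤ} {n : ℕ} (h : IsCoprime (y ^ 2 + m * z) m)
    (hn : (n : ℤ) ∣ m) : jacobiSym (y ^ 2 + m * z) n = 1 := by
  have hy : IsCoprime y n := by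
    have : IsCoprime (y ^ 2) m := (IsCoprime.add_mul_left_left_iff (z := z)).mp h
    exact (this.of_isCoprime_of_dvd_right hn).of_isCoprime_of_dvd_left (dvd_pow_self y two_ne_zero)
  rw [jacobiSym.mod_left' (a₂ := y ^ 2), jacobiSym.sq_one' (by simpa using Int.isCoprime_iff_gcd_eq_one.mp hy)]
  obtain ⟨k, rfl⟩ := hn
  rw [mul_assoc, Int.add_mul_emod_self_left]

theorem Int.sq_emod_eight (y : ℤ) :
    (y % 2 = 0 ∧ (y ^ 2 % 8 = 0 ∨ y ^ 2 % 8 = 4)) ∨ (y % 2 = 1 ∧ y ^ 2 % 8 = 1) := by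
  have h : y % 8 = 0 ∨ y % 8 = 1 ∨ y % 8 = 2 ∨ y % 8 = 3 ∨ y % 8 = 4 ∨ y % 8 = 5 ∨ y % 8 = 6 ∨
    y % 8 = 7 := by omega
  rw [sq, Int.mul_emod]
  rcases h with h | h | h | h | h | h | h | h <;> rw [h] <;> norm_num <;> omega

/-- The Kronecker symbol of `ℓ` is trivial on the norms `(x² - ℓ D z²) / 4` prime to `ℓ`. -/
theorem kronecker_eq_one_of_norm {ℓ D x z : ℤ} {w : ℕ} (hℓ : IsFundDisc ℓ) (hD : IsFundDisc D)
    (hw : IsCoprime (w : ℤ) ℓ) (hw0 : w ≠ 0) (h : 4 * (w : ℤ) = x ^ 2 - ℓ * D * z ^ 2) :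
    kronecker ℓ w = 1 := by
  rcases hℓ with ⟨h1, -⟩ | ⟨h0, hm, -⟩
  · rw [kronecker_of_emod_four_eq_one h1 hw0]
    have ho : Odd ℓ.natAbs := Nat.odd_iff.mpr (by omega)
    have h4 : IsCoprime (4 : ℤ) ℓ := ⟨-(ℓ / 4), 1, by omega⟩
    have e : 4 * (w : ℤ) = x ^ 2 + ℓ * (-D * z ^ 2) := by rw [h]; ring
    have := jacobiSym_sq_add_mul (n := ℓ.natAbs) (e ▸ h4.mul_left hw) (by simp)
    rw [← e, jacobiSym.mul_left, jacobiSym.at_four ho, one_mul] at this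
    exact this
  · obtain ⟨m, rfl⟩ : ∃ m, ℓ = 4 * m := ⟨ℓ / 4, by omega⟩
    rw [show 4 * m / 4 = m by omega] at hm
    have hwo : (w : ℤ) % 2 = 1 := by
      obtain ⟨u, v, huv⟩ := hw
      by_contra hc
      have : (w : ℤ) = 2 * (w / 2) := by omega
      rw [this] at huv
      have : 2 * (u * (w / 2 : ℤ) + v * (2 * m)) = 1 := by linarith
      omega
    have hwo' : Odd w := Nat.odd_iff.mpr (by omega)
    obtain ⟨y, rfl⟩ : ∃ y, x = 2 * y := by
      refine ⟨x / 2, ?_⟩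
      have hx : x ^ 2 = 4 * (w + m * D * z ^ 2) := by linarith
      rcases x.sq_emod_eight with h | h <;> omega
    have e : (w : ℤ) = y ^ 2 + m * (-D * z ^ 2) := by linarith
    have hwm : IsCoprime (w : ℤ) m := hw.of_mul_right_right
    rw [kronecker_odd _ hwo', jacobiSym.mul_left, jacobiSym.at_four hwo', one_mul]
    -- Only D ≡ 0, 1 mod 4 is needed of D, which leaves few residues of Dz².
    have hDz : D * z ^ 2 % 8 = 0 ∨ D * z ^ 2 % 8 = 4 ∨ D * z ^ 2 % 4 = 1 := by
      have hz := z.sq_emod_eight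
      have hD8 : D % 8 = 0 ∨ D % 8 = 4 ∨ D % 8 = 1 ∨ D % 8 = 5 := by
        have := hD.emod_four; omega
      rw [show D * z ^ 2 % 4 = D * z ^ 2 % 8 % 4 by omega, Int.mul_emod]
      rcases hz with ⟨-, hz | hz⟩ | ⟨-, hz⟩ <;> rcases hD8 with h | h | h | h <;> rw [hz, h] <;>
        norm_num
    have hy := y.sq_emod_eight
    rcases hm with hm | hm
    -- Since w is odd, so is y, and w ≡ 1 or 1 - 2m₁ mod 8. On these residues the character that
    -- accompanies (w/|m₁|) is 1.
    · obtain ⟨m₁, rfl⟩ : ∃ m₁, m = 2 * m₁ := ⟨m / 2, by omega⟩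
      have e2 : (w : ℤ) = y ^ 2 - 2 * (m₁ * (D * z ^ 2)) := by rw [e]; ring
      have hJ : jacobiSym w m₁.natAbs = 1 := by
        rw [e]; exact jacobiSym_sq_add_mul (e ▸ hwm) (by simp)
      have hmul : m₁ * (D * z ^ 2) % 4 = (m₁ % 4) * (D * z ^ 2 % 4) % 4 := Int.mul_emod _ _ _
      rw [jacobiSym.mul_left, jacobiSym.at_two hwo']
      have h13 : m₁ % 4 = 1 ∨ m₁ % 4 = 3 := by omega
      rcases h13 with h1 | h3
      · rw [jacobiSym_of_emod_four_eq_one h1 hwo', hJ, mul_one, ZMod.χ₈_nat_eq_if_mod_eight]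
        rw [h1] at hmul
        have : w % 8 = 1 ∨ w % 8 = 7 := by omega
        rw [if_neg (by omega), if_pos this]
      · rw [jacobiSym_of_emod_four_eq_three h3 hwo', hJ, mul_one, ZMod.χ₈_nat_eq_if_mod_eight, ZMod.χ₄_nat_eq_if_mod_four]
        rw [h3] at hmul
        have : w % 8 = 1 ∨ w % 8 = 3 := by omega
        rcases this with h | h
        · rw [if_neg (by omega), if_pos (by omega), if_neg (by omega), if_pos (by omega)]; rfl
        · rw [if_neg (by omega), if_neg (by omega), if_neg (by omega), if_neg (by omega)]; rfl
    -- Modulo 4, w is y² + Dz² with both terms 0 or 1; being odd, it is 1.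
    · have hJ : jacobiSym w m.natAbs = 1 := by
        rw [e]; exact jacobiSym_sq_add_mul (e ▸ hwm) (by simp)
      have e2 : (w : ℤ) = y ^ 2 - m * (D * z ^ 2) := by rw [e]; ring
      have hmul : m * (D * z ^ 2) % 4 = (m % 4) * (D * z ^ 2 % 4) % 4 := Int.mul_emod _ _ _
      rw [hm] at hmul
      have h4 : w % 4 = 1 := by omega
      rw [jacobiSym_of_emod_four_eq_three hm hwo', hJ, mul_one, ZMod.χ₄_nat_one_mod_four h4]

theorem kronecker_sq_eq_one {m : ℤ} (hm : IsFundDisc m) {n : ℕ} (hn : n ≠ 0)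
    (h : IsCoprime (n : ℤ) m) : kronecker m n * kronecker m n = 1 := by
  rw [← kronecker_mul_right m hn hn]
  refine kronecker_eq_one_of_norm (D := 1) (x := 2 * n) (z := 0) hm isFundDisc_one ?_
    (mul_ne_zero hn hn) (by push_cast; ring)
  push_cast
  exact h.mul_left h

/-- All integers prime to `ℓ` represented by a form of discriminant `ℓ D` have the same
Kronecker symbol. -/
theorem BQForm.kronecker_eval_eq {ℓ D : ℤ} (hℓ : IsFundDisc ℓ) (hD : IsFundDisc D) {T : BQForm}
    (hT : T.disc = ℓ * D) {x y x' y' : ℤ} {n n' : ℕ} (hn : T.eval x y = n)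
    (hn' : T.eval x' y' = n') (h0 : n ≠ 0) (h0' : n' ≠ 0) (h : IsCoprime (n : ℤ) ℓ)
    (h' : IsCoprime (n' : ℤ) ℓ) : kronecker ℓ n = kronecker ℓ n' := by
  -- The identity is 4T(v)T(v') = B(v, v')² - disc(T) · det(v, v')², with B the polar form; it makes
  -- nn' a norm.
  have hk : kronecker ℓ ((n * n' : ℕ) : ℤ) = 1 := by
    refine kronecker_eq_one_of_norm hℓ hD (by push_cast; exact h.mul_left h')
      (mul_ne_zero h0 h0') (x := 2 * T.a * x * x' + T.b * (x * y' + x' * y) + 2 * T.c * y * y')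
      (z := x * y' - x' * y) ?_
    push_cast
    rw [← hn, ← hn', ← hT, eval, eval, disc]
    ring
  rw [kronecker_mul_right _ h0 h0'] at hk
  have := kronecker_sq_eq_one hℓ h0' h'
  calc kronecker ℓ n = kronecker ℓ n * (kronecker ℓ n' * kronecker ℓ n') := by rw [this, mul_one]
    _ = kronecker ℓ n' := by rw [← mul_assoc, hk, one_mul]

/-! ## The auxiliary prime -/

theorem IsFundDisc.ne_zero {D : ℤ} (hD : IsFundDisc D) : D ≠ 0 := by
  rintro rfl
  rcases hD with h | h <;> omega

theorem Nat.eq_one_of_forall_odd_prime_not_dvd {n : ℕ} (hn : Odd n)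
    (h : ∀ p : ℕ, p.Prime → p ≠ 2 → ¬ p ∣ n) : n = 1 := by
  by_contra hne
  refine h n.minFac (Nat.minFac_prime hne) (fun h2 => ?_) n.minFac_dvd
  exact hn.not_two_dvd_nat (h2 ▸ n.minFac_dvd)

/-- If ℓ = ps with p an odd prime, then p ∤ s. Taking b ≡ 1 mod 4|s| and b a nonresidue mod p gives
(s/b) = 1 and (p/b) = (b/p) = -1. Without odd prime divisors, only -4 and ±8 remain. -/
theorem IsFundDisc.exists_jacobiSym_eq_neg_one {ℓ : ℤ} (hℓ : IsFundDisc ℓ) (h1 : ℓ ≠ 1) :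
    ∃ b : ℕ, Odd b ∧ jacobiSym ℓ b = -1 := by
  by_cases hp : ∃ p : ℕ, p.Prime ∧ p ≠ 2 ∧ (p : ℤ) ∣ ℓ
  · obtain ⟨p, hp, hp2, s, rfl⟩ := hp
    have : Fact p.Prime := ⟨hp⟩
    have hs : ¬ (p : ℤ) ∣ s := by
      rintro ⟨t, rfl⟩
      exact hℓ.not_sq_dvd hp hp2 ⟨t, by ring⟩
    have hs0 : 0 < s.natAbs := Int.natAbs_pos.mpr (right_ne_zero_of_mul hℓ.ne_zero)
    obtain ⟨a, ha⟩ := FiniteField.exists_nonsquare (F := ZMod p) (by rwa [ZMod.ringChar_zmod_n])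
    have hco : Nat.Coprime (4 * s.natAbs) p := by
      refine Nat.Coprime.mul_left ?_ ?_
      · exact Nat.Coprime.pow_left 2 ((Nat.coprime_primes Nat.prime_two hp).mpr (Ne.symm hp2))
      · exact ((Nat.Prime.coprime_iff_not_dvd hp).mpr fun h => hs (Int.natCast_dvd.mpr h)).symm
    obtain ⟨b, hb1, hb2⟩ := Nat.chineseRemainder hco 1 a.val
    have hb4 : b % 4 = 1 := hb1.of_mul_right _
    have hbo : Odd b := Nat.odd_iff.mpr (by omega)
    refine ⟨b, hbo, ?_⟩
    have e1 : jacobiSym s b = 1 := by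
      rw [jacobiSym.mod_right s hbo, hb1, Nat.mod_eq_of_lt (by omega), jacobiSym.one_right]
    rw [jacobiSym.mul_left, e1, mul_one,
      jacobiSym.quadratic_reciprocity_one_mod_four' (hp.odd_of_ne_two hp2) hb4,
      ZMod.nonsquare_iff_jacobiSym_eq_neg_one]
    have : ((b : ℤ) : ZMod p) = a := by
      rw [Int.cast_natCast, (ZMod.natCast_eq_natCast_iff _ _ _).mpr hb2, ZMod.natCast_val,
        ZMod.cast_id]
    rwa [this]
  · push Not at hp
    have key : ∀ m : ℤ, m % 2 = 1 → m ∣ ℓ → m = 1 ∨ m = -1 := fun m hm hmℓ => by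
      have := Nat.eq_one_of_forall_odd_prime_not_dvd (n := m.natAbs) (Nat.odd_iff.mpr (by omega))
        fun p hpp hp2 hd => hp p hpp hp2 ((Int.natCast_dvd.mpr hd).trans hmℓ)
      omega
    rcases hℓ with ⟨h4, -⟩ | ⟨h4, hm, -⟩
    · have := key ℓ (by omega) dvd_rfl
      omega
    · have hℓ' : ℓ = -4 ∨ ℓ = 8 ∨ ℓ = -8 := by
        rcases hm with hm | hm
        · have := key (ℓ / 8) (by omega) ⟨8, by omega⟩
          omega
        · have := key (ℓ / 4) (by omega) ⟨4, by omega⟩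
          omega
      rcases hℓ' with rfl | rfl | rfl
      · exact ⟨3, by decide, by norm_num⟩
      · exact ⟨3, by decide, by norm_num⟩
      · exact ⟨5, by decide, by norm_num⟩

/-- For odd b both symbols depend only on b mod 4|ℓD|, so Dirichlet's theorem replaces b by a prime.
-/
theorem exists_prime_jacobiSym_eq {ℓ D : ℤ} {b : ℕ} (hb : Odd b) (hℓ : jacobiSym ℓ b ≠ 0)
    (hD : jacobiSym D b ≠ 0) (hℓ0 : ℓ ≠ 0) (hD0 : D ≠ 0) (n : ℕ) :
    ∃ q : ℕ, n < q ∧ q.Prime ∧ q ≠ 2 ∧ jacobiSym ℓ q = jacobiSym ℓ b ∧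
      jacobiSym D q = jacobiSym D b := by
  have hb0 : b ≠ 0 := by rintro rfl; simp at hb
  have hco : ∀ m : ℤ, jacobiSym m b ≠ 0 → b.Coprime m.natAbs := fun m hm => by
    rw [Ne, jacobiSym.eq_zero_iff] at hm
    push Not at hm
    exact Nat.Coprime.symm (hm hb0)
  have hM : b.Coprime (4 * (ℓ.natAbs * D.natAbs)) :=
    Nat.Coprime.mul_right (Nat.Coprime.pow_right 2 (Nat.coprime_two_right.mpr hb))
      (Nat.Coprime.mul_right (hco ℓ hℓ) (hco D hD))
  obtain ⟨q, hqn, hq, hmod⟩ := Nat.forall_exists_prime_gt_and_modEq n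
    (mul_ne_zero four_ne_zero (mul_ne_zero (Int.natAbs_ne_zero.mpr hℓ0)
      (Int.natAbs_ne_zero.mpr hD0))) hM
  have h4 : q % 4 = b % 4 := hmod.of_mul_right _
  have hb2 := Nat.odd_iff.mp hb
  have hqo : Odd q := Nat.odd_iff.mpr (by omega)
  refine ⟨q, hqn, hq, by rintro rfl; omega, ?_, ?_⟩
  · rw [jacobiSym.mod_right _ hqo, jacobiSym.mod_right _ hb]
    rw [← mul_assoc] at hmod
    congr 1
    exact hmod.of_mul_right _
  · rw [jacobiSym.mod_right _ hqo, jacobiSym.mod_right _ hb]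
    rw [mul_left_comm] at hmod
    congr 1
    exact hmod.of_mul_left _

/-- Take b with (ℓ/b) = -1 and (D/b) = ±1, and c with the roles of ℓ and D exchanged. One of b, c,
bc has both symbols -1. -/
theorem IsFundDisc.exists_prime_jacobiSym_eq_neg_one {ℓ D : ℤ} (hℓ : IsFundDisc ℓ)
    (hD : IsFundDisc D) (hℓ1 : ℓ ≠ 1) (hD1 : D ≠ 1) (n : ℕ) :
    ∃ q : ℕ, n < q ∧ q.Prime ∧ q ≠ 2 ∧ jacobiSym ℓ q = -1 ∧ jacobiSym D q = -1 := by
  have single : ∀ {m m' : ℤ}, IsFundDisc m → m' ≠ 0 → m ≠ 1 →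
      ∃ q : ℕ, Odd q ∧ jacobiSym m q = -1 ∧ (jacobiSym m' q = 1 ∨ jacobiSym m' q = -1) := by
    intro m m' hm hm' hm1
    obtain ⟨b, hb, hbm⟩ := hm.exists_jacobiSym_eq_neg_one hm1
    -- A prime larger than |m'| does not divide m', so the second symbol is ±1 rather than 0.
    obtain ⟨q, hqn, hq, hq2, e, -⟩ := exists_prime_jacobiSym_eq (ℓ := m) (D := 1) hb
      (by rw [hbm]; norm_num) (by simp [jacobiSym.one_left]) hm.ne_zero one_ne_zero m'.natAbs
    refine ⟨q, hq.odd_of_ne_two hq2, e.trans hbm, jacobiSym.eq_one_or_neg_one ?_⟩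
    refine Nat.Coprime.symm ((Nat.Prime.coprime_iff_not_dvd hq).mpr fun hd => ?_)
    exact absurd (Nat.le_of_dvd (Int.natAbs_pos.mpr hm') hd) (by simp; omega)
  have done : ∀ {b : ℕ}, Odd b → jacobiSym ℓ b = -1 → jacobiSym D b = -1 →
      ∃ q : ℕ, n < q ∧ q.Prime ∧ q ≠ 2 ∧ jacobiSym ℓ q = -1 ∧ jacobiSym D q = -1 := by
    intro b hb h1 h2
    have := exists_prime_jacobiSym_eq hb (by rw [h1]; norm_num) (by rw [h2]; norm_num)
      hℓ.ne_zero hD.ne_zero n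
    rwa [h1, h2] at this
  obtain ⟨b, hb, hb1, hb2⟩ := single hℓ hD.ne_zero hℓ1
  obtain ⟨c, hc, hc1, hc2⟩ := single hD hℓ.ne_zero hD1
  rcases hb2 with hb2 | hb2
  · rcases hc2 with hc2 | hc2
    · have hb0 : b ≠ 0 := by rintro rfl; simp at hb
      have hc0 : c ≠ 0 := by rintro rfl; simp at hc
      exact done (hb.mul hc) (by rw [jacobiSym.mul_right' _ hb0 hc0, hb1, hc2]; rfl)
        (by rw [jacobiSym.mul_right' _ hb0 hc0, hb2, hc1]; rfl)
    · exact done hc hc2 hc1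
  · exact done hb hb1 hb2

/-! ## The genus character -/

namespace BQForm

theorem genusGcd_dvd {N : ℕ} {ℓ : ℤ} {T : BQForm} :
    (genusGcd N ℓ T : ℤ) ∣ N ∧ (genusGcd N ℓ T : ℤ) ∣ T.b ∧ (genusGcd N ℓ T : ℤ) ∣ T.c ∧
      (genusGcd N ℓ T : ℤ) ∣ ℓ := by
  simp only [Int.natCast_dvd, Int.natAbs_natCast, ← Nat.dvd_gcd_iff]
  exact dvd_rfl

theorem genusGcd_dvd_act {N : ℕ} {ℓ : ℤ} {T : BQForm} (hT : (N : ℤ) ∣ T.a) {U : SL(2, ℤ)} :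
    genusGcd N ℓ T ∣ genusGcd N ℓ (T.act U) := by
  obtain ⟨h1, h2, h3, h4⟩ := genusGcd_dvd (N := N) (ℓ := ℓ) (T := T)
  have h0 := h1.trans hT
  generalize (genusGcd N ℓ T) = g at *
  refine Nat.dvd_gcd (by exact_mod_cast h1) (Nat.dvd_gcd (Int.natCast_dvd.mp ?_)
    (Nat.dvd_gcd (Int.natCast_dvd.mp ?_) (Int.natCast_dvd.mp h4)))
  · simp only [act, mul_assoc]
    exact dvd_add (dvd_add (Dvd.dvd.mul_left (h0.mul_right _) _) (h2.mul_right _))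
      (Dvd.dvd.mul_left (h3.mul_right _) _)
  · simp only [act, mul_assoc]
    exact dvd_add (dvd_add (h0.mul_right _) (h2.mul_right _)) (h3.mul_right _)

theorem act_dvd_a {N : ℕ} {T : BQForm} (hT : (N : ℤ) ∣ T.a) {U : SL(2, ℤ)}
    (hU : U ∈ CongruenceSubgroup.Gamma0 N) : (N : ℤ) ∣ (T.act U).a := by
  have hU := mem_Gamma0_iff_dvd.mp hU
  simp only [act]
  exact dvd_add (dvd_add (hT.mul_right _) (hU.mul_left _))
    (Dvd.dvd.mul_left (dvd_pow hU two_ne_zero) _)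

theorem genusGcd_act {N : ℕ} {ℓ : ℤ} {T : BQForm} (hT : (N : ℤ) ∣ T.a) {U : SL(2, ℤ)}
    (hU : U ∈ CongruenceSubgroup.Gamma0 N) : genusGcd N ℓ (T.act U) = genusGcd N ℓ T := by
  refine Nat.dvd_antisymm ?_ (genusGcd_dvd_act hT)
  have := genusGcd_dvd_act (ℓ := ℓ) (act_dvd_a hT hU) (U := U⁻¹)
  rwa [← act_mul, mul_inv_cancel, act_one] at this

/-- `gcd(a, b, c, ℓ)` for `T = [N a, b, c]`. -/
def genusContent (N : ℕ) (ℓ : ℤ) (T : BQForm) : ℕ :=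
  Nat.gcd (T.a / N).natAbs (Nat.gcd T.b.natAbs (Nat.gcd T.c.natAbs ℓ.natAbs))

theorem genusChar_eq_ite (N : ℕ) (ℓ : ℤ) (T : BQForm) :
    genusChar N ℓ T = if genusContent N ℓ T = 1 then
      kronecker ℓ (Classical.epsilon fun n : ℤ =>
          (∃ x y : ℤ, (tildeForm N ℓ T).eval x y = n) ∧ IsCoprime n ℓ) *
        ∏ p ∈ (genusGcd N ℓ T).primeFactors, localSign ℓ p
    else 0 := rfl

theorem genusContent_dvd_act {N : ℕ} (hN : 0 < N) {ℓ : ℤ} {T : BQForm} (hT : (N : ℤ) ∣ T.a)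
    {U : SL(2, ℤ)} (hU : U ∈ CongruenceSubgroup.Gamma0 N) :
    genusContent N ℓ T ∣ genusContent N ℓ (T.act U) := by
  obtain ⟨a, ha⟩ := hT
  obtain ⟨s, hs⟩ := mem_Gamma0_iff_dvd.mp hU
  have hN' : (N : ℤ) ≠ 0 := by positivity
  have h : (genusContent N ℓ T : ℤ) ∣ a ∧ (genusContent N ℓ T : ℤ) ∣ T.b ∧
      (genusContent N ℓ T : ℤ) ∣ T.c ∧ (genusContent N ℓ T : ℤ) ∣ ℓ := by
    have : a = T.a / N := by rw [ha, Int.mul_ediv_cancel_left _ hN']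
    rw [this]
    simp only [Int.natCast_dvd, ← Nat.dvd_gcd_iff]
    exact dvd_rfl
  obtain ⟨h1, h2, h3, h4⟩ := h
  generalize (genusContent N ℓ T) = g at *
  have e : (T.act U).a / N = a * U 0 0 ^ 2 + T.b * (U 0 0 * s) + T.c * (s * U 1 0) := by
    apply Int.ediv_eq_of_eq_mul_right hN'
    simp only [act]
    rw [ha, hs]; ring
  refine Nat.dvd_gcd ?_ (Nat.dvd_gcd (Int.natCast_dvd.mp ?_)
    (Nat.dvd_gcd (Int.natCast_dvd.mp ?_) (Int.natCast_dvd.mp h4)))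
  · rw [e]
    exact Int.natCast_dvd.mp (dvd_add (dvd_add (h1.mul_right _) (h2.mul_right _)) (h3.mul_right _))
  · simp only [act, mul_assoc, ha]
    exact dvd_add (dvd_add (Dvd.dvd.mul_left (Dvd.dvd.mul_left (h1.mul_right _) _) _)
      (h2.mul_right _)) (Dvd.dvd.mul_left (h3.mul_right _) _)
  · simp only [act, mul_assoc, ha]
    exact dvd_add (dvd_add (Dvd.dvd.mul_left (h1.mul_right _) _) (h2.mul_right _)) (h3.mul_right _)

theorem genusContent_act {N : ℕ} (hN : 0 < N) {ℓ : ℤ} {T : BQForm} (hT : (N : ℤ) ∣ T.a)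
    {U : SL(2, ℤ)} (hU : U ∈ CongruenceSubgroup.Gamma0 N) :
    genusContent N ℓ (T.act U) = genusContent N ℓ T := by
  refine Nat.dvd_antisymm ?_ (genusContent_dvd_act hN hT hU)
  have := genusContent_dvd_act (ℓ := ℓ) hN (act_dvd_a hT hU) (inv_mem hU)
  rwa [← act_mul, mul_inv_cancel, act_one] at this

theorem genusGcd_pos {N : ℕ} (hN : 0 < N) (ℓ : ℤ) (T : BQForm) : 0 < genusGcd N ℓ T :=
  Nat.gcd_pos_of_pos_left _ hN

/-- With g = gcd(N, b, c, ℓ), this presents [Na/g, b, cg] as 1/g times T restricted to ℤ × gℤ. As g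
∣ N, Γ₀(N) preserves this lattice, whence the invariance of the represented values. -/
theorem genusGcd_mul_eval_tildeForm {N : ℕ} {ℓ : ℤ} {T : BQForm} (hT : (N : ℤ) ∣ T.a) (x y : ℤ) :
    genusGcd N ℓ T * (tildeForm N ℓ T).eval x y = T.eval x (genusGcd N ℓ T * y) := by
  have h := Int.mul_ediv_cancel' ((genusGcd_dvd (N := N) (ℓ := ℓ) (T := T)).1.trans hT)
  simp only [tildeForm, eval]
  linear_combination x ^ 2 * h

theorem disc_tildeForm {N : ℕ} {ℓ : ℤ} {T : BQForm} (hT : (N : ℤ) ∣ T.a) :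
    (tildeForm N ℓ T).disc = T.disc := by
  have h := Int.mul_ediv_cancel' ((genusGcd_dvd (N := N) (ℓ := ℓ) (T := T)).1.trans hT)
  simp only [tildeForm, disc]
  linear_combination (-4 * T.c) * h

theorem exists_eval_tildeForm_of_act {N : ℕ} (hN : 0 < N) {ℓ : ℤ} {T : BQForm}
    (hT : (N : ℤ) ∣ T.a) {U : SL(2, ℤ)} (hU : U ∈ CongruenceSubgroup.Gamma0 N) {n : ℤ}
    (h : ∃ x y : ℤ, (tildeForm N ℓ (T.act U)).eval x y = n) :
    ∃ x y : ℤ, (tildeForm N ℓ T).eval x y = n := by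
  obtain ⟨x, y, rfl⟩ := h
  have e := genusGcd_mul_eval_tildeForm (ℓ := ℓ) (act_dvd_a hT hU) x y
  rw [eval_act, genusGcd_act hT hU] at e
  obtain ⟨s, hs⟩ := (genusGcd_dvd (N := N) (ℓ := ℓ) (T := T)).1.trans (mem_Gamma0_iff_dvd.mp hU)
  have hg : (genusGcd N ℓ T : ℤ) ≠ 0 := by exact_mod_cast (genusGcd_pos hN ℓ T).ne'
  refine ⟨U 0 0 * x + U 0 1 * (genusGcd N ℓ T * y), s * x + U 1 1 * y, ?_⟩
  apply mul_left_cancel₀ hg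
  rw [e, genusGcd_mul_eval_tildeForm hT, hs]
  congr 1; ring

/-- The genus character is invariant under `Γ₀(N)`. -/
theorem genusChar_act {N : ℕ} (hN : 0 < N) {ℓ : ℤ} {T : BQForm} (hT : (N : ℤ) ∣ T.a)
    {U : SL(2, ℤ)} (hU : U ∈ CongruenceSubgroup.Gamma0 N) :
    genusChar N ℓ (T.act U) = genusChar N ℓ T := by
  -- The two predicates are equal, so `Classical.epsilon` picks the same n and independence of the
  -- choice is not needed.
  have hv : (fun n : ℤ => (∃ x y : ℤ, (tildeForm N ℓ (T.act U)).eval x y = n) ∧ IsCoprime n ℓ) =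
      fun n : ℤ => (∃ x y : ℤ, (tildeForm N ℓ T).eval x y = n) ∧ IsCoprime n ℓ := by
    ext n
    refine and_congr_left fun _ => ⟨exists_eval_tildeForm_of_act hN hT hU, fun h => ?_⟩
    refine exists_eval_tildeForm_of_act hN (act_dvd_a hT hU) (inv_mem hU) ?_
    rwa [← act_mul, mul_inv_cancel, act_one]
  simp only [genusChar_eq_ite, hv, genusContent_act hN hT hU, genusGcd_act hT hU]

/-- This makes the definition of χ_ℓ meaningful: an n prime to ℓ exists. Let p divide the form. If p
∣ g, then p divides T and hence D, so p ∣ N/g would give p² ∣ N; if p ∤ g, then p ∣ N/g would put p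
into g. Either way p ∣ a, against the content condition. -/
theorem prime_not_dvd_tildeForm {N : ℕ} (hN : 0 < N) {ℓ D ρ : ℤ} (hℓ : IsFundDisc ℓ)
    (hD : IsFundDisc D)
    (hp2 : ∀ p : ℕ, p.Prime → (p : ℤ) ∣ ℓ → (p : ℤ) ∣ D → ¬ p ^ 2 ∣ N)
    {T : BQForm} (hT : T ∈ formsOf N (ℓ * D) ρ) (hcont : genusContent N ℓ T = 1)
    {p : ℕ} (hp : p.Prime) (hpℓ : (p : ℤ) ∣ ℓ) (h1 : (p : ℤ) ∣ (tildeForm N ℓ T).a)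
    (h2 : (p : ℤ) ∣ (tildeForm N ℓ T).b) (h3 : (p : ℤ) ∣ (tildeForm N ℓ T).c) : False := by
  have hpp : Prime (p : ℤ) := Nat.prime_iff_prime_int.mp hp
  obtain ⟨a, ha⟩ := hT.1.1
  have hN' : (N : ℤ) ≠ 0 := by positivity
  have hdisc : T.b ^ 2 - 4 * T.a * T.c = ℓ * D := hT.2.1
  have haN : T.a / N = a := by rw [ha, Int.mul_ediv_cancel_left _ hN']
  have hprim : (p : ℤ) ∣ a → (p : ℤ) ∣ T.c → False := fun q1 q2 => by
    have : p ∣ genusContent N ℓ T := by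
      refine Nat.dvd_gcd ?_ (Nat.dvd_gcd (Int.natCast_dvd.mp h2)
        (Nat.dvd_gcd (Int.natCast_dvd.mp q2) (Int.natCast_dvd.mp hpℓ)))
      rw [haN]; exact Int.natCast_dvd.mp q1
    rw [hcont] at this
    exact hp.one_lt.ne' (Nat.dvd_one.mp this)
  obtain ⟨g1, g2, g3, g4⟩ := genusGcd_dvd (N := N) (ℓ := ℓ) (T := T)
  have hg : ∀ d : ℕ, (d : ℤ) ∣ N → (d : ℤ) ∣ T.b → (d : ℤ) ∣ T.c → (d : ℤ) ∣ ℓ →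
      d ∣ genusGcd N ℓ T := fun d d1 d2 d3 d4 =>
    Nat.dvd_gcd (by exact_mod_cast d1) (Nat.dvd_gcd (Int.natCast_dvd.mp d2)
      (Nat.dvd_gcd (Int.natCast_dvd.mp d3) (Int.natCast_dvd.mp d4)))
  simp only [tildeForm] at h1 h2 h3
  generalize genusGcd N ℓ T = g at *
  obtain ⟨M, hM⟩ := g1
  have hg0 : (g : ℤ) ≠ 0 := by rintro h; rw [h, zero_mul] at hM; exact hN' hM
  have hag : T.a / g = M * a := by
    rw [ha, hM, mul_assoc, Int.mul_ediv_cancel_left _ hg0]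
  rw [hag] at h1
  have hpA : (p : ℤ) ∣ T.a := by rw [ha, hM, mul_assoc]; exact h1.mul_left _
  by_cases hpg : p ∣ g
  · have hpg' : (p : ℤ) ∣ g := by exact_mod_cast hpg
    have hpc : (p : ℤ) ∣ T.c := hpg'.trans g3
    have hpD : (p : ℤ) ∣ D := hD.dvd_of_dvd_form hℓ (hdisc.trans (mul_comm _ _)) hp hpA h2 hpc
    rcases hpp.dvd_or_dvd h1 with h | h
    · refine hp2 p hp hpℓ hpD ?_
      have : (p : ℤ) ^ 2 ∣ N := by rw [hM, sq]; exact mul_dvd_mul hpg' h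
      exact_mod_cast this
    · exact hprim h hpc
  · have hpc : (p : ℤ) ∣ T.c := (hpp.dvd_or_dvd h3).resolve_right
      fun h => hpg (by exact_mod_cast h)
    rcases hpp.dvd_or_dvd h1 with h | h
    · exact hpg (hg p (hM ▸ h.mul_left _) h2 hpc hpℓ)
    · exact hprim h hpc

/-- The genus character changes its sign under `[A, b, c q] ↦ [A q, b, c]` if `(ℓ / q) = -1`. -/
theorem genusChar_mul_prime {N : ℕ} (hN : 0 < N) {ℓ D ρ : ℤ} (hℓ : IsFundDisc ℓ)
    (hD : IsFundDisc D) (hℓ1 : ℓ ≠ 1) (hneg : ℓ * D < 0)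
    (hp2 : ∀ p : ℕ, p.Prime → (p : ℤ) ∣ ℓ → (p : ℤ) ∣ D → ¬ p ^ 2 ∣ N) {q : ℕ} (hq : q.Prime)
    (hq2 : q ≠ 2) (hqℓ : jacobiSym ℓ q = -1) {A b c : ℤ}
    (hT : ⟨A, b, c * q⟩ ∈ formsOf N (ℓ * D) ρ) (hT' : ⟨A * q, b, c⟩ ∈ formsOf N (ℓ * D) ρ)
    (hNA : (N : ℤ) ∣ A) :
    genusChar N ℓ ⟨A * q, b, c⟩ = -genusChar N ℓ ⟨A, b, c * q⟩ := by
  have hcoℓ : q.Coprime ℓ.natAbs := by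
    refine (Nat.Prime.coprime_iff_not_dvd hq).mpr fun hd => ?_
    have : jacobiSym ℓ q = 0 := by
      rw [jacobiSym.eq_zero_iff]
      refine ⟨hq.ne_zero, fun h => hq.one_lt.ne' (Nat.dvd_one.mp (h ▸ ?_))⟩
      exact Nat.dvd_gcd hd (by simp)
    rw [hqℓ] at this; omega
  have hgc : Nat.gcd (c * q).natAbs ℓ.natAbs = Nat.gcd c.natAbs ℓ.natAbs := by
    rw [Int.natAbs_mul, Int.natAbs_natCast, Nat.Coprime.gcd_mul_right_cancel _ hcoℓ]
  have hcont : genusContent N ℓ ⟨A * q, b, c⟩ = genusContent N ℓ ⟨A, b, c * q⟩ := by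
    simp only [genusContent, hgc]
    rw [Int.mul_comm A, Int.mul_ediv_assoc _ hNA, Int.natAbs_mul, Int.natAbs_natCast,
      Nat.Coprime.gcd_mul_left_cancel]
    exact (hcoℓ.coprime_dvd_right ((Nat.gcd_dvd_right _ _).trans (Nat.gcd_dvd_right _ _)))
  have hgcd : genusGcd N ℓ ⟨A * q, b, c⟩ = genusGcd N ℓ ⟨A, b, c * q⟩ := by
    simp only [genusGcd, hgc]
  rw [genusChar_eq_ite, genusChar_eq_ite]
  by_cases h1 : genusContent N ℓ ⟨A, b, c * q⟩ = 1
  swap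
  · rw [if_neg (by rwa [← hcont] at h1), if_neg h1, neg_zero]
  have h1' := hcont.trans h1
  rw [if_pos h1', if_pos h1, hgcd, neg_mul_eq_neg_mul]
  congr 1
  have ex := (tildeForm N ℓ ⟨A, b, c * q⟩).exists_eval_isCoprime hℓ.ne_zero
    fun p hp => prime_not_dvd_tildeForm hN hℓ hD hp2 hT h1 hp
  have ex' := (tildeForm N ℓ ⟨A * q, b, c⟩).exists_eval_isCoprime hℓ.ne_zero
    fun p hp => prime_not_dvd_tildeForm hN hℓ hD hp2 hT' h1' hp
  obtain ⟨⟨x, y, hn⟩, hco⟩ := Classical.epsilon_spec (p := fun n : ℤ =>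
    (∃ x y : ℤ, (tildeForm N ℓ ⟨A, b, c * q⟩).eval x y = n) ∧ IsCoprime n ℓ)
    (let ⟨x, y, _, h⟩ := ex; ⟨_, ⟨x, y, rfl⟩, h⟩)
  obtain ⟨⟨x', y', hn'⟩, hco'⟩ := Classical.epsilon_spec (p := fun n : ℤ =>
    (∃ x y : ℤ, (tildeForm N ℓ ⟨A * q, b, c⟩).eval x y = n) ∧ IsCoprime n ℓ)
    (let ⟨x, y, _, h⟩ := ex'; ⟨_, ⟨x, y, rfl⟩, h⟩)
  generalize (Classical.epsilon fun n : ℤ =>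
    (∃ x y : ℤ, (tildeForm N ℓ ⟨A, b, c * q⟩).eval x y = n) ∧ IsCoprime n ℓ) = n at hn hco ⊢
  generalize (Classical.epsilon fun n : ℤ =>
    (∃ x y : ℤ, (tildeForm N ℓ ⟨A * q, b, c⟩).eval x y = n) ∧ IsCoprime n ℓ) = n' at hn' hco' ⊢
  have hga := (genusGcd_dvd (N := N) (ℓ := ℓ) (T := ⟨A, b, c * q⟩)).1.trans hNA
  have hgpos : (0 : ℤ) < genusGcd N ℓ ⟨A, b, c * q⟩ := by exact_mod_cast genusGcd_pos hN _ _
  have hApos : 0 < A := a_pos_of_mem hneg hT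
  -- The first form represents q times every value n' of the second, so `kronecker_eval_eq` yields
  -- (ℓ/n) = (ℓ/q)(ℓ/n').
  have hmul : (tildeForm N ℓ ⟨A, b, c * q⟩).eval (q * x') y' = q * n' := by
    rw [← hn']
    simp only [tildeForm, eval, hgcd]
    rw [Int.mul_comm A, Int.mul_ediv_assoc _ hga]
    ring
  have hd : (tildeForm N ℓ ⟨A, b, c * q⟩).disc = ℓ * D :=
    (disc_tildeForm hNA).trans hT.2.1
  have htpos : 0 < (tildeForm N ℓ ⟨A, b, c * q⟩).a :=
    Int.ediv_pos_of_pos_of_dvd hApos hgpos.le hga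
  have hnn := eval_nonneg (hd ▸ hneg) htpos
  have hn0 : 0 ≤ n := hn ▸ hnn _ _
  have hqpos : (0 : ℤ) < q := by exact_mod_cast hq.pos
  have hn0' : 0 ≤ n' := by
    have := hnn (q * x') y'
    rw [hmul] at this
    exact nonneg_of_mul_nonneg_right this hqpos
  have hne : ∀ m : ℤ, IsCoprime m ℓ → m ≠ 0 := by
    rintro m hm rfl
    rcases Int.isUnit_iff.mp (isCoprime_zero_left.mp hm) with h | h
    · exact hℓ1 h
    · have := hℓ.emod_four; omega
  lift n to ℕ using hn0
  lift n' to ℕ using hn0'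
  have hnz : n ≠ 0 := by exact_mod_cast hne _ hco
  have hnz' : n' ≠ 0 := by exact_mod_cast hne _ hco'
  have hqco : IsCoprime (q : ℤ) ℓ := by
    rw [Int.isCoprime_iff_gcd_eq_one]; exact hcoℓ
  have key := kronecker_eval_eq hℓ hD hd hn (n' := q * n') (by rw [hmul]; push_cast; rfl) hnz
    (mul_ne_zero hq.ne_zero hnz') hco (by push_cast; exact hqco.mul_left hco')
  rw [kronecker_mul_right _ hq.ne_zero hnz', kronecker_odd _ (hq.odd_of_ne_two hq2), hqℓ] at key
  rw [key]; ring

end BQForm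

/-! ## Multiplication by a prime form -/

namespace BQForm

variable {N : ℕ} {Δ ρ r : ℤ} {q : ℕ}

/-- Once q does not divide the leading coefficient a, a translation makes b ≡ r mod q, and 4ac = b²
- Δ forces q ∣ c. -/
theorem exists_act_dvd_c (hq : q.Prime) (hq2 : q ≠ 2) (hqN : ¬ (q : ℤ) ∣ N)
    (hr : ¬ (q : ℤ) ∣ r) (hrΔ : (q : ℤ) ∣ r ^ 2 - Δ) {T : BQForm} (hT : T.disc = Δ) :
    ∃ U ∈ CongruenceSubgroup.Gamma0 N, (q : ℤ) ∣ (T.act U).c ∧ (q : ℤ) ∣ (T.act U).b - r := by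
  have hqq : Prime (q : ℤ) := Nat.prime_iff_prime_int.mp hq
  have h2 : ¬ (q : ℤ) ∣ 2 := fun h => hq2 ((Nat.prime_dvd_prime_iff_eq hq Nat.prime_two).mp
    (by exact_mod_cast h))
  have step : ∃ U ∈ CongruenceSubgroup.Gamma0 N, ¬ (q : ℤ) ∣ (T.act U).a := by
    by_contra! hall
    have h0 := hall 1 (one_mem _)
    have h1 := hall _ (lowerUnipotent_mem (s := N) dvd_rfl)
    have h3 := hall _ (lowerUnipotent_mem (s := N * 2) (dvd_mul_right _ _))
    rw [act_one] at h0
    rw [act_lowerUnipotent] at h1 h3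
    -- The combination 4T(1, N) - T(1, 2N) - 3T(1, 0) equals 2Nb.
    have e : (q : ℤ) ∣ 2 * N * T.b := by
      have := dvd_sub (dvd_sub (h1.mul_left 4) h3) (h0.mul_left 3)
      ring_nf at this ⊢
      exact this
    have hb : (q : ℤ) ∣ T.b := (hqq.dvd_or_dvd e).resolve_left fun h =>
      (hqq.dvd_or_dvd h).elim h2 hqN
    refine hr (hqq.dvd_of_dvd_pow (n := 2) ?_)
    have e : r ^ 2 = r ^ 2 - Δ + T.b * T.b - T.a * (4 * T.c) := by
      rw [← hT, disc]; ring
    rw [e]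
    exact dvd_sub (dvd_add hrΔ (hb.mul_right _)) (h0.mul_right _)
  obtain ⟨U, hU, hA⟩ := step
  have hd := disc_act T U
  rw [hT] at hd
  generalize hS : T.act U = S at hA hd
  have hA2 : ¬ (q : ℤ) ∣ 2 * S.a := fun h => (hqq.dvd_or_dvd h).elim h2 hA
  obtain ⟨u, v, huv⟩ := ((Prime.coprime_iff_not_dvd hqq).mpr hA2).symm
  have hd' := disc_act S (upperUnipotent (u * (r - S.b)))
  refine ⟨U * upperUnipotent (u * (r - S.b)), mul_mem hU (upperUnipotent_mem _), ?_⟩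
  rw [act_mul, hS]
  have hb : (q : ℤ) ∣ (S.act (upperUnipotent (u * (r - S.b)))).b - r := by
    rw [act_upperUnipotent]
    exact ⟨-v * (r - S.b), by linear_combination (r - S.b) * huv⟩
  have ha : (S.act (upperUnipotent (u * (r - S.b)))).a = S.a := by rw [act_upperUnipotent]
  refine ⟨?_, hb⟩
  generalize S.act (upperUnipotent (u * (r - S.b))) = R at hb ha hd'
  have h4 : (q : ℤ) ∣ 2 * (2 * S.a) * R.c := by
    have e : 2 * (2 * S.a) * R.c = (R.b - r) * (R.b + r) + (r ^ 2 - Δ) := by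
      rw [← hd, ← hd', ← ha, disc]; ring
    rw [e]
    exact dvd_add (hb.mul_right _) hrΔ
  exact (hqq.dvd_or_dvd h4).resolve_left fun h => (hqq.dvd_or_dvd h).elim h2 hA2

/-- With q ∣ c and b ≡ r invertible mod q, the congruence a + bs ≡ 0 has a solution s divisible by
N. -/
theorem exists_act_dvd_a (hq : q.Prime) (hq2 : q ≠ 2) (hqN : ¬ (q : ℤ) ∣ N)
    (hr : ¬ (q : ℤ) ∣ r) (hrΔ : (q : ℤ) ∣ r ^ 2 - Δ) {T : BQForm} (hT : T.disc = Δ) :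
    ∃ U ∈ CongruenceSubgroup.Gamma0 N, (q : ℤ) ∣ (T.act U).a ∧ (q : ℤ) ∣ (T.act U).b - r := by
  have hqq : Prime (q : ℤ) := Nat.prime_iff_prime_int.mp hq
  obtain ⟨U, hU, hc, hb⟩ := exists_act_dvd_c hq hq2 hqN hr hrΔ hT
  generalize hS : T.act U = S at hc hb
  have hbN : ¬ (q : ℤ) ∣ S.b * N := fun h => (hqq.dvd_or_dvd h).elim
    (fun h => hr (by simpa using dvd_sub h hb)) hqN
  obtain ⟨u, v, huv⟩ := ((Prime.coprime_iff_not_dvd hqq).mpr hbN).symm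
  refine ⟨U * lowerUnipotent (N * (-u * S.a)),
    mul_mem hU (lowerUnipotent_mem (dvd_mul_right _ _)), ?_⟩
  rw [act_mul, hS, act_lowerUnipotent]
  constructor
  · have e : S.a + S.b * (N * (-u * S.a)) + S.c * (N * (-u * S.a)) ^ 2 =
        q * (v * S.a) + S.c * (N * (-u * S.a)) ^ 2 := by
      linear_combination (-S.a) * huv
    simp only [e]
    exact dvd_add (dvd_mul_right _ _) (hc.mul_right _)
  · have e : S.b + 2 * S.c * (N * (-u * S.a)) - r =
        (S.b - r) + S.c * (2 * (N * (-u * S.a))) := by ring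
    simp only [e]
    exact dvd_add hb (hc.mul_right _)

theorem not_dvd_add_of_dvd_sub (hq : q.Prime) (hq2 : q ≠ 2) (hr : ¬ (q : ℤ) ∣ r) {b b' : ℤ}
    (hb : (q : ℤ) ∣ b - r) (hb' : (q : ℤ) ∣ b' - r) : ¬ (q : ℤ) ∣ b + b' := by
  intro h
  have h2 : (q : ℤ) ∣ 2 * r := by
    have := dvd_sub h (dvd_add hb hb')
    ring_nf at this ⊢
    exact this
  rcases (Nat.prime_iff_prime_int.mp hq).dvd_or_dvd h2 with h | h
  · exact hq2 ((Nat.prime_dvd_prime_iff_eq hq Nat.prime_two).mp (by exact_mod_cast h))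
  · exact hr h

/-- If q ∤ U 0 1, the last coefficient forces A·U₀₁ + b·U₁₁ ≡ 0 mod q, whence b' ≡ -b, contrary to b
≡ b' ≡ r. So q ∣ U 0 1, and conjugating U by diag(1, q) gives an integral V. -/
theorem exists_act_mul_a (hq : q.Prime) (hq2 : q ≠ 2) (hr : ¬ (q : ℤ) ∣ r)
    {A b c A' b' c' : ℤ} (hb : (q : ℤ) ∣ b - r) (hb' : (q : ℤ) ∣ b' - r)
    {U : SL(2, ℤ)} (hU : U ∈ CongruenceSubgroup.Gamma0 N)
    (h : (⟨A, b, c * q⟩ : BQForm).act U = ⟨A', b', c' * q⟩) :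
    ∃ V ∈ CongruenceSubgroup.Gamma0 N,
      (⟨A * q, b, c⟩ : BQForm).act V = ⟨A' * q, b', c'⟩ := by
  have hqq : Prime (q : ℤ) := Nat.prime_iff_prime_int.mp hq
  have hdet := SL2_det U
  have e1 := congrArg BQForm.a h
  have e2 := congrArg BQForm.b h
  have e3 := congrArg BQForm.c h
  simp only [act] at e1 e2 e3
  have hy : (q : ℤ) ∣ U 0 1 := by
    by_contra hy
    have h1 : (q : ℤ) ∣ U 0 1 * (A * U 0 1 + b * U 1 1) :=
      ⟨c' - c * U 1 1 ^ 2, by linear_combination e3⟩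
    obtain ⟨k, hk⟩ := (hqq.dvd_or_dvd h1).resolve_left hy
    exact not_dvd_add_of_dvd_sub hq hq2 hr hb hb' ⟨2 * U 0 0 * k + 2 * c * U 1 0 * U 1 1, by
      linear_combination 2 * U 0 0 * hk - e2 - b * hdet⟩
  obtain ⟨y, hy⟩ := hy
  rw [hy] at hdet e2 e3
  refine ⟨⟨!![U 0 0, y; q * U 1 0, U 1 1], by
    rw [Matrix.det_fin_two_of]; linear_combination hdet⟩, ?_, ?_⟩
  · have hU := mem_Gamma0_iff_dvd.mp hU
    exact mem_Gamma0_iff_dvd.mpr (by simpa using hU.mul_left _)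
  · rw [BQForm.ext_iff]
    simp only [act, Matrix.of_apply, Matrix.cons_val', Matrix.cons_val_zero,
      Matrix.cons_val_one, Matrix.cons_val_fin_one]
    refine ⟨by linear_combination q * e1, by linear_combination e2, ?_⟩
    apply mul_left_cancel₀ hqq.ne_zero
    linear_combination e3

/-- The converse of `exists_act_mul_a`, by the same argument with q ∣ U 1 0. Dividing this entry by
q keeps it divisible by N since q ∤ N. -/
theorem exists_act_mul_c (hq : q.Prime) (hq2 : q ≠ 2) (hqN : ¬ (q : ℤ) ∣ N)
    (hr : ¬ (q : ℤ) ∣ r)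
    {A b c A' b' c' : ℤ} (hb : (q : ℤ) ∣ b - r) (hb' : (q : ℤ) ∣ b' - r)
    {U : SL(2, ℤ)} (hU : U ∈ CongruenceSubgroup.Gamma0 N)
    (h : (⟨A * q, b, c⟩ : BQForm).act U = ⟨A' * q, b', c'⟩) :
    ∃ V ∈ CongruenceSubgroup.Gamma0 N,
      (⟨A, b, c * q⟩ : BQForm).act V = ⟨A', b', c' * q⟩ := by
  have hqq : Prime (q : ℤ) := Nat.prime_iff_prime_int.mp hq
  have hdet := SL2_det U
  have e1 := congrArg BQForm.a h
  have e2 := congrArg BQForm.b h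
  have e3 := congrArg BQForm.c h
  simp only [act] at e1 e2 e3
  have hz : (q : ℤ) ∣ U 1 0 := by
    by_contra hz
    have h1 : (q : ℤ) ∣ U 1 0 * (b * U 0 0 + c * U 1 0) :=
      ⟨A' - A * U 0 0 ^ 2, by linear_combination e1⟩
    obtain ⟨k, hk⟩ := (hqq.dvd_or_dvd h1).resolve_left hz
    exact not_dvd_add_of_dvd_sub hq hq2 hr hb hb' ⟨2 * U 1 1 * k + 2 * A * U 0 0 * U 0 1, by
      linear_combination 2 * U 1 1 * hk - e2 - b * hdet⟩
  obtain ⟨z, hz⟩ := hz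
  rw [mem_Gamma0_iff_dvd, hz] at hU
  rw [hz] at hdet e1 e2
  refine ⟨⟨!![U 0 0, q * U 0 1; z, U 1 1], by
    rw [Matrix.det_fin_two_of]; linear_combination hdet⟩, ?_, ?_⟩
  · exact mem_Gamma0_iff_dvd.mpr (by
      simpa using ((Prime.coprime_iff_not_dvd hqq).mpr hqN).symm.dvd_of_dvd_mul_left hU)
  · rw [BQForm.ext_iff]
    simp only [act, Matrix.of_apply, Matrix.cons_val', Matrix.cons_val_zero,
      Matrix.cons_val_one, Matrix.cons_val_fin_one]
    refine ⟨?_, by linear_combination e2, by linear_combination q * e3⟩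
    apply mul_left_cancel₀ hqq.ne_zero
    linear_combination e1

theorem mul_a_mem {A b c : ℤ} (hΔ : Δ < 0) (h : ⟨A, b, c * q⟩ ∈ formsOf N Δ ρ) :
    ⟨A * q, b, c⟩ ∈ formsOf N Δ ρ := by
  have hc : 0 < c * q := c_pos_of_mem hΔ h
  have hc' : 0 ≤ c := (pos_of_mul_pos_left hc (by positivity)).le
  have hd : disc ⟨A * q, b, c⟩ = disc ⟨A, b, c * q⟩ := by simp only [disc]; ring
  exact ⟨⟨h.1.1.mul_right _, mul_nonneg h.1.2.1 (by positivity), hc', hd ▸ h.1.2.2.2⟩,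
    hd ▸ h.2.1, h.2.2⟩

theorem mul_c_mem {A b c : ℤ} (hΔ : Δ < 0) (hq : q.Prime) (hqN : ¬ (q : ℤ) ∣ N)
    (h : ⟨A * q, b, c⟩ ∈ formsOf N Δ ρ) : ⟨A, b, c * q⟩ ∈ formsOf N Δ ρ := by
  have ha : 0 < A * q := a_pos_of_mem hΔ h
  have ha' : 0 ≤ A := (pos_of_mul_pos_left ha (by positivity)).le
  have hd : disc ⟨A, b, c * q⟩ = disc ⟨A * q, b, c⟩ := by simp only [disc]; ring
  have hco := ((Prime.coprime_iff_not_dvd (Nat.prime_iff_prime_int.mp hq)).mpr hqN).symm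
  exact ⟨⟨hco.dvd_of_dvd_mul_right h.1.1, ha', mul_nonneg h.1.2.2.1 (by positivity),
    hd ▸ h.1.2.2.2⟩, hd ▸ h.2.1, h.2.2⟩

theorem Classes.rep_mem {G : Subgroup SL(2, ℤ)} {S : Set BQForm} (c : Classes G S) : c.rep ∈ S :=
  (Quotient.out c).2

theorem Classes.exists_act_rep {G : Subgroup SL(2, ℤ)} {S : Set BQForm} (T : S) :
    ∃ U ∈ G, T.1.act U = Classes.rep (G := G) (S := S) (Quotient.mk _ T) :=
  Quotient.exact (Quotient.out_eq (s := classSetoid G S) _).symm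

/-- A function on forms that is invariant under `Γ₀(N)` and changes its sign under
`[A, b, c q] ↦ [A q, b, c]` sums to zero over the classes. -/
theorem finsum_classes_eq_zero {R : Type*} [AddCommGroup R] [IsAddTorsionFree R] 
    (hΔ : Δ < 0) (hq : q.Prime) (hq2 : q ≠ 2) (hqN : ¬ (q : ℤ) ∣ N)
    (hr : ¬ (q : ℤ) ∣ r) (hrΔ : (q : ℤ) ∣ r ^ 2 - Δ) (f : BQForm → R)
    (hf : ∀ T ∈ formsOf N Δ ρ, ∀ U ∈ CongruenceSubgroup.Gamma0 N, f (T.act U) = f T)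
    (hfq : ∀ A b c : ℤ, ⟨A, b, c * q⟩ ∈ formsOf N Δ ρ → f ⟨A * q, b, c⟩ = -f ⟨A, b, c * q⟩) :
    ∑ᶠ x : Classes (CongruenceSubgroup.Gamma0 N) (formsOf N Δ ρ), f x.rep = 0 := by
  let C := Classes (CongruenceSubgroup.Gamma0 N) (formsOf N Δ ρ)
  let mk : formsOf N Δ ρ → C := Quotient.mk (classSetoid _ _)
  have hrep : ∀ T : formsOf N Δ ρ, f (Classes.rep (mk T)) = f T.1 := by
    intro T
    obtain ⟨U, hU, h⟩ := Classes.exists_act_rep (G := CongruenceSubgroup.Gamma0 N) T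
    rw [← hf T.1 T.2 U hU, h]
  have low : ∀ x : C, ∃ t : ℤ × ℤ × ℤ, ∃ ht : ⟨t.1, t.2.1, t.2.2 * q⟩ ∈ formsOf N Δ ρ,
      (q : ℤ) ∣ t.2.1 - r ∧ mk ⟨_, ht⟩ = x := by
    rintro ⟨T⟩
    obtain ⟨U, hU, ⟨c, hc⟩, hb⟩ := exists_act_dvd_c hq hq2 hqN hr hrΔ T.2.2.1
    have hm := act_mem_formsOf hΔ T.2 hU
    have e : (⟨(T.1.act U).a, (T.1.act U).b, c * q⟩ : BQForm) = T.1.act U := by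
      rw [mul_comm, ← hc]
    refine ⟨((T.1.act U).a, (T.1.act U).b, c), by rw [e]; exact hm, hb, ?_⟩
    exact (Quotient.sound (s := classSetoid _ _) ⟨U, hU, e.symm⟩).symm
  choose t ht hb hx using low
  -- σ uses chosen representatives. `exists_act_mul_c` makes it injective; `exists_act_mul_a` shows
  -- independence of the choice, which gives surjectivity.
  let σ : C → C := fun x => mk ⟨_, mul_a_mem hΔ (ht x)⟩
  have hσ : Function.Bijective σ := by
    constructor
    · intro x y hxy
      obtain ⟨U, hU, h⟩ := Quotient.exact hxy
      obtain ⟨V, hV, h'⟩ := exists_act_mul_c hq hq2 hqN hr (hb x) (hb y) hU h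
      rw [← hx x, ← hx y]
      exact Quotient.sound ⟨V, hV, h'⟩
    · rintro ⟨T⟩
      obtain ⟨U, hU, ⟨a, ha⟩, hbT⟩ := exists_act_dvd_a hq hq2 hqN hr hrΔ T.2.2.1
      have hm := act_mem_formsOf hΔ T.2 hU
      have e : (⟨a * q, (T.1.act U).b, (T.1.act U).c⟩ : BQForm) = T.1.act U := by
        rw [mul_comm, ← ha]
      have hm' := mul_c_mem hΔ hq hqN (e.symm ▸ hm)
      refine ⟨mk ⟨_, hm'⟩, ?_⟩
      obtain ⟨V, hV, h⟩ := Quotient.exact (hx (mk ⟨_, hm'⟩))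
      obtain ⟨W, hW, h'⟩ := exists_act_mul_a hq hq2 hr (hb _) hbT hV h
      have h2 : mk ⟨_, mul_a_mem hΔ hm'⟩ = Quotient.mk _ T :=
        (Quotient.sound (s := classSetoid _ _) ⟨U, hU, e.symm⟩).symm
      refine Eq.trans ?_ h2
      exact Quotient.sound (s := classSetoid _ _) ⟨W, hW, h'⟩
  -- Reindexing by a bijection and pulling out the sign need no finiteness of the set of classes.
  have key : ∑ᶠ x : C, -f (Classes.rep x) = ∑ᶠ x : C, f (Classes.rep x) :=
    finsum_eq_of_bijective σ hσ fun x => by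
      rw [hrep, hfq _ _ _ (ht x), ← hrep ⟨_, ht x⟩, hx]
  rw [finsum_neg_distrib] at key
  exact neg_eq_self.mp key

end BQForm

/-! ## The averages -/

/-- For `T ∈ 𝒬_{N,Δ,ρ}` with coprime `a, b, c`, the Fourier coefficient of `Grit(φ)` at `T` is
`c_ρ(Δ)`. -/
theorem ParamodularForm.IsGrit.fourierCoeff_eq_coeffRho {k N : ℕ} (hN : 0 < N)
    {F : ParamodularForm k N} {φ : JacobiForm k N} (hF : F.IsGrit φ) {Δ ρ : ℤ} (hΔ : Δ < 0)
    {T : BQForm} (hT : T ∈ BQForm.formsOf N Δ ρ)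
    (hprim : Nat.gcd (T.a / N).natAbs (Nat.gcd T.b.natAbs T.c.natAbs) = 1) :
    F.fourierCoeff T = φ.coeffRho Δ ρ := by
  rw [hF.fourierCoeff_eq hT.1, JacobiForm.gritCoeff, if_neg, hprim]
  · simp only [Nat.divisors_one, Finset.sum_singleton, Nat.cast_one, one_zpow, one_mul, one_pow,
      Int.ediv_one]
    refine φ.coeff_eq_coeffRho hN ?_ hT.2.2
    rw [← hT.2.1, BQForm.disc]
    linear_combination (-4 * T.c) * Int.mul_ediv_cancel' hT.1.1
  · rintro rfl
    exact (BQForm.a_pos_of_mem hΔ hT).ne' rfl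

theorem BQForm.gcd_eq_one_of_mem {N : ℕ} {Δ ρ : ℤ} {T : BQForm}
    (hT : T ∈ formsOf N Δ ρ)
    (h : ∀ p : ℕ, p.Prime → (p : ℤ) ∣ T.a / N → (p : ℤ) ∣ T.a → (p : ℤ) ∣ T.b → (p : ℤ) ∣ T.c →
      False) :
    Nat.gcd (T.a / N).natAbs (Nat.gcd T.b.natAbs T.c.natAbs) = 1 :=
  Nat.gcd_gcd_eq_one_of_forall_prime fun p hp h1 =>
    h p hp h1 (Int.mul_ediv_cancel' hT.1.1 ▸ h1.mul_left _)

/-- For infinite α both sides are 0 by convention, so finiteness of the class number need not be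
shown. -/
theorem finsum_const_eq_card_mul (α : Type*) (z : ℂ) : ∑ᶠ _ : α, z = Nat.card α * z := by
  rcases finite_or_infinite α with h | h
  · have := Fintype.ofFinite α
    simp [finsum_eq_sum_of_fintype]
  · rw [Nat.card_eq_zero_of_infinite, Nat.cast_zero, zero_mul]
    by_cases hz : z = 0
    · simp [hz]
    · refine finsum_of_infinite_support ?_
      rw [Function.support_const hz]
      exact Set.infinite_univ

theorem ParamodularForm.IsGrit.avgRho_eq {k N : ℕ} (hN : 0 < N) {F : ParamodularForm k N}
    {φ : JacobiForm k N} (hF : F.IsGrit φ) {D ρ : ℤ} (hD : IsFundDisc D) (hD0 : D < 0)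
    (hρ : ρ ^ 2 ≡ D [ZMOD 4 * N]) :
    F.avgRho D ρ = φ.coeffRho D ρ * ((formClassNumber D : ℂ) / (unitCount D : ℂ)) := by
  have h : ∀ x : BQForm.Classes (CongruenceSubgroup.Gamma0 N) (BQForm.formsOf N D ρ),
      F.fourierCoeff x.rep / (x.rep.stabCard N : ℂ) = φ.coeffRho D ρ / (unitCount D : ℂ) := by
    intro x
    have hx := x.rep_mem
    have hprim := BQForm.gcd_eq_one_of_mem hx fun p hp _ =>
      BQForm.prime_not_dvd_of_mem hD hx hp
    rw [hF.fourierCoeff_eq_coeffRho hN hD0 hx hprim,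
      BQForm.stabCard_eq_unitCount hN (hx.2.1.trans_lt hD0) hx.1.1 hprim, hx.2.1]
  simp only [avgRho, h]
  rw [← BQForm.card_classes_formsOf hN hD hD0 hρ, finsum_const_eq_card_mul]
  ring

/-- The constant z serves two purposes: c_ρ(ℓD)/w in ℂ for the averages, and 1 in ℤ for the plain
character sum. -/
theorem BQForm.finsum_genusChar_mul_eq_zero {N : ℕ} (hN : 0 < N) {ℓ D ρ : ℤ} (hℓ : IsFundDisc ℓ)
    (hD : IsFundDisc D) (hℓ1 : ℓ ≠ 1) (hD1 : D ≠ 1) (hneg : ℓ * D < 0)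
    (hp2 : ∀ p : ℕ, p.Prime → (p : ℤ) ∣ ℓ → (p : ℤ) ∣ D → ¬ p ^ 2 ∣ N)
    {R : Type*} [CommRing R] [IsAddTorsionFree R] (z : R) :
    ∑ᶠ x : Classes (CongruenceSubgroup.Gamma0 N) (formsOf N (ℓ * D) ρ),
      (genusChar N ℓ x.rep : R) * z = 0 := by
  -- The bound keeps q from dividing N and ℓD; (ℓD/q) = (-1)(-1) = 1 then provides the root r.
  obtain ⟨q, hqn, hq, hq2, hqℓ, hqD⟩ := hℓ.exists_prime_jacobiSym_eq_neg_one hD hℓ1 hD1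
    (N + (ℓ * D).natAbs)
  have : Fact q.Prime := ⟨hq⟩
  have hqN : ¬ (q : ℤ) ∣ N := fun h => by
    have := Nat.le_of_dvd hN (by exact_mod_cast h); omega
  have hqΔ : ¬ (q : ℤ) ∣ ℓ * D := fun h => by
    have := Nat.le_of_dvd (Int.natAbs_pos.mpr hneg.ne) (Int.natCast_dvd.mp h); omega
  obtain ⟨s, hs⟩ := ZMod.isSquare_of_jacobiSym_eq_one (p := q) (a := ℓ * D)
    (by rw [jacobiSym.mul_left, hqℓ, hqD]; rfl)
  have hrΔ : (q : ℤ) ∣ (s.val : ℤ) ^ 2 - ℓ * D := by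
    rw [← ZMod.intCast_zmod_eq_zero_iff_dvd, Int.cast_sub, hs]
    simp [sq]
  have hr : ¬ (q : ℤ) ∣ (s.val : ℤ) := fun h =>
    hqΔ (by simpa using dvd_sub (dvd_pow h two_ne_zero) hrΔ)
  refine finsum_classes_eq_zero hneg hq hq2 hqN hr hrΔ (fun T => (genusChar N ℓ T : R) * z) ?_ ?_
  · intro T hT U hU
    simp only [genusChar_act hN hT.1.1 hU]
  · intro A b c hT
    simp only [genusChar_mul_prime hN hℓ hD hℓ1 hneg hp2 hq hq2 hqℓ hT (mul_a_mem hneg hT) hT.1.1]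
    push_cast; ring

theorem ParamodularForm.IsGrit.twistedAvgRho_eq_zero {k N : ℕ} (hN : 0 < N)
    {F : ParamodularForm k N} {φ : JacobiForm k N} (hF : F.IsGrit φ) {ℓ D ρ : ℤ}
    (hℓ : IsFundDisc ℓ) (hD : IsFundDisc D) (hℓ1 : ℓ ≠ 1) (hD1 : D ≠ 1) (hneg : ℓ * D < 0)
    (hp2 : ∀ p : ℕ, p.Prime → (p : ℤ) ∣ ℓ → (p : ℤ) ∣ D → ¬ p ^ 2 ∣ N) :
    F.twistedAvgRho ℓ D ρ = 0 := by
  rw [← BQForm.finsum_genusChar_mul_eq_zero hN hℓ hD hℓ1 hD1 hneg hp2 (ρ := ρ)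
    (φ.coeffRho (ℓ * D) ρ / (unitCount (ℓ * D) : ℂ))]
  refine finsum_congr fun x => ?_
  -- Outside content 1 the character vanishes and a(T;F) is irrelevant. For content 1, a common
  -- prime of a, b, c would divide ℓ and hence the content, so a, b, c are coprime.
  by_cases hc : BQForm.genusContent N ℓ x.rep = 1
  swap
  · rw [BQForm.genusChar_eq_ite, if_neg hc]; simp
  have hx := x.rep_mem
  have hprim := BQForm.gcd_eq_one_of_mem hx fun p hp h0 h1 h2 h3 => by
    have hpℓ := hℓ.dvd_of_dvd_form hD hx.2.1 hp h1 h2 h3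
    have : p ∣ BQForm.genusContent N ℓ x.rep :=
      Nat.dvd_gcd (Int.natCast_dvd.mp h0) (Nat.dvd_gcd (Int.natCast_dvd.mp h2)
        (Nat.dvd_gcd (Int.natCast_dvd.mp h3) (Int.natCast_dvd.mp hpℓ)))
    rw [hc] at this
    exact hp.one_lt.ne' (Nat.dvd_one.mp this)
  rw [hF.fourierCoeff_eq_coeffRho hN hneg hx hprim,
    BQForm.stabCard_eq_unitCount hN (hx.2.1.trans_lt hneg) hx.1.1 hprim, hx.2.1]

theorem mainTheorem2 (k N : ℕ) (hN : 0 < N) (φ : JacobiForm k N) (F : ParamodularForm k N)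
    (hF : F.IsGrit φ) :
    (∀ D : ℤ, IsFundDisc D → D < 0 →
      F.avg D = φ.coeffStar D * ((formClassNumber D : ℝ) / (unitCount D : ℝ))) ∧
    (∀ ℓ D : ℤ, IsFundDisc ℓ → IsFundDisc D → ℓ ≠ 1 → D ≠ 1 → ℓ * D < 0 →
      (∀ p : ℕ, p.Prime → (p : ℤ) ∣ ℓ → (p : ℤ) ∣ D → ¬ p ^ 2 ∣ N) →
      F.twistedAvg ℓ D = 0 ∧ F.signedTwistedAvg ℓ D = 0 ∧
      ∀ ρ ∈ rootsMod N (ℓ * D),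
        (∑ᶠ q : BQForm.Classes (CongruenceSubgroup.Gamma0 N) (BQForm.formsOf N (ℓ * D) ρ),
          genusChar N ℓ q.rep) = 0) := by
  refine ⟨fun D hD hD0 => ?_, fun ℓ D hℓ hD hℓ1 hD1 hneg hp2 => ⟨?_, ?_, fun ρ _ => ?_⟩⟩
  · rw [ParamodularForm.avg, JacobiForm.coeffStar, mul_assoc, Finset.sum_mul]
    congr 1
    refine Finset.sum_congr rfl fun ρ hρ => ?_
    rw [hF.avgRho_eq hN hD hD0 (Finset.mem_filter.mp hρ).2, norm_mul, norm_div,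
      Complex.norm_natCast, Complex.norm_natCast]
  · simp [ParamodularForm.twistedAvg,
      hF.twistedAvgRho_eq_zero hN hℓ hD hℓ1 hD1 hneg hp2]
  · simp [ParamodularForm.signedTwistedAvg,
      hF.twistedAvgRho_eq_zero hN hℓ hD hℓ1 hD1 hneg hp2]
  · simpa using BQForm.finsum_genusChar_mul_eq_zero hN hℓ hD hℓ1 hD1 hneg hp2 (ρ := ρ) (1 : ℤ)
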